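/- Let $(M,g)$ be a nonempty compact smooth Riemannian manifold without boundary, of dimension $n\ge 1$, with Levi-Civita connection $\nabla$. Let $(E,\tilde g)$ be a smooth Riemannian vector bundle over $M$ of rank $m\ge 2$ with projection $\pi$ and with a smooth metric connection $\tilde\nabla$. Let $E_*$ be $E$ with the zero section removed and $\Sigma=\{\xi\in E:\|\xi\|=1\}$ the unit sphere bundle. A radial graph over $\Sigma$ is a hypersurface $\mathcal Y=\{e^{u(\xi)}\xi:\xi\in\Sigma\}$ with $u\in C^\infty(\Sigma)$. Its vertical Gaussian curvature at $\eta\in\mathcal Y$ is the Gaussian curvature at $\eta$ of $\mathcal Y\cap E_{\pi(\eta)}$ as a hypersurface of the Euclidean space $E_{\pi(\eta)}$, with principal curvatures taken so that those of round spheres are positive. Let $G$ be the metric on $E$ that makes the horizontal distribution of $\tilde\nabla$ and the vertical distribution orthogonal and restricts to (the lift of) $g$ on the former and to $\tilde g$ on the latter. Let $D$ be the Sasaki connection on $TE$: for vector fields $X,Y$ on $M$ and sections $s,t$ of $E$, with horizontal lifts $X^h,Y^h$ and vertical lifts $s^v,t^v$, one has $D_{X^h}Y^h=(\nabla_XY)^h$,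 $D_{X^h}t^v=(\tilde\nabla_Xt)^v$, $D_{s^v}Y^h=0$, $D_{s^v}t^v=0$. The graph $\mathcal Y$ is convex if its second fundamental form $(A,B)\mapsto G(D_AN,B)$, with $N$ the outward $G$-unit normal, is positive semidefinite: $G(D_AN,A)\ge 0$ for every $A$ tangent to $\mathcal Y$. Two radial graphs are homothetic if one is the image of the other under $\xi\mapsto c\,\xi$ for some constant $c>0$. Let $K\in C^\infty(E_*)$ be a strictly positive function such that $K(\xi)$ depends only on $\|\xi\|$. (1) If there is a real $r>0$ with $K(r\xi)=r^{1-m}$ for all $\xi\in\Sigma$, then there is a radial graph over $\Sigma$ whose vertical Gaussian curvature is given by $K$, and it can be chosen to be convex. (2) Conversely, if there is a radial graph over $\Sigma$ whose vertical Gaussian curvature is given by $K$, then there is a real $r>0$ with $K(r\xi)=r^{1-m}$ for all $\xi\in\Sigma$. (3) If $K(r\xi)=r^{1-m}$ for all $r>0$ and all $\xi\in\Sigma$, then there are infinitely many pairwise non-homothetic radial graphs over $\Sigma$ whose vertical Gaussian curvature is given by $K$. Among them there is a convex one, and if $M$ is connected, any two convex ones are homothetic. -/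

import Mathlib

open Bundle Manifold
open scoped ContDiff

noncomputable section

/-! ### Gaussian curvature of a level hypersurface of a Euclidean space -/

section Euclidean

variable {V : Type*} [NormedAddCommGroup V] [InnerProductSpace ℝ V] [CompleteSpace V]

/-- The Gauss map of the level hypersurfaces of `f`: the unit normal field pointing towards
increasing values of `f`. -/
def gaussMap (f : V → ℝ) (p : V) : V := ‖gradient f p‖⁻¹ • gradient f p

/-- The tangent space at `p` of the level hypersurface of `f` through `p`. -/
abbrev levelTangent (f : V → ℝ) (p : V) : Submodule ℝ V := (Submodule.span ℝ {gradient f p})ᗮ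

/-- The shape operator at `p` of the level hypersurface of `f` through `p`: the differential of the
Gauss map, as an endomorphism of the tangent space. -/
def shapeOperator (f : V → ℝ) (p : V) : levelTangent f p →ₗ[ℝ] levelTangent f p :=
  ((levelTangent f p).orthogonalProjectionOnto.toLinearMap ∘ₗ
    (fderiv ℝ (gaussMap f) p).toLinearMap) ∘ₗ (levelTangent f p).subtype

/-- The Gaussian curvature at `p` of the level hypersurface of `f` through `p`: the product of its
principal curvatures. With `f` increasing outwards, spheres have positive principal curvatures. -/
def gaussCurvature (f : V → ℝ) (p : V) : ℝ := LinearMap.det (shapeOperator f p)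

end Euclidean

/-! ### The Levi-Civita connection -/

section LeviCivita

variable {EM : Type*} [NormedAddCommGroup EM] [NormedSpace ℝ EM] [FiniteDimensional ℝ EM]
  {H : Type*} [TopologicalSpace H] (I : ModelWithCorners ℝ EM H)
  {M : Type*} [TopologicalSpace M] [ChartedSpace H M] [IsManifold I ∞ M]
  [RiemannianBundle (fun x : M ↦ TangentSpace I x)]

/-- The right-hand side of the Koszul formula for `2 g(∇_X Y, Z)`. -/
def koszul (X Y Z : Π x : M, TangentSpace I x) (x : M) : ℝ :=
  mvfderiv I (fun y ↦ inner ℝ (Y y) (Z y)) x (X x)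
    + mvfderiv I (fun y ↦ inner ℝ (Z y) (X y)) x (Y x)
    - mvfderiv I (fun y ↦ inner ℝ (X y) (Y y)) x (Z x)
    + inner ℝ (VectorField.mlieBracket I X Y x) (Z x)
    - inner ℝ (VectorField.mlieBracket I Y Z x) (X x)
    - inner ℝ (VectorField.mlieBracket I X Z x) (Y x)

/-- The Levi-Civita connection `∇_X Y` at `x`: the vector with
`2 g(∇_X Y, Z) = koszul X Y Z` for all `Z`, written out in an orthonormal basis of `T_x M`. -/
def leviCivita (X Y : Π x : M, TangentSpace I x) (x : M) : TangentSpace I x :=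
  haveI : FiniteDimensional ℝ (TangentSpace I x) := inferInstanceAs (FiniteDimensional ℝ EM)
  let b := stdOrthonormalBasis ℝ (TangentSpace I x)
  ∑ i, (koszul I X Y (FiberBundle.extend EM (b i)) x / 2) • b i

end LeviCivita

/-! ### The total space of a Riemannian vector bundle with a metric connection -/

section Sasaki

variable {EM : Type*} [NormedAddCommGroup EM] [NormedSpace ℝ EM] [FiniteDimensional ℝ EM]
  {H : Type*} [TopologicalSpace H] {I : ModelWithCorners ℝ EM H}
  {M : Type*} [TopologicalSpace M] [ChartedSpace H M] [IsManifold I ∞ M]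
  [RiemannianBundle (fun x : M ↦ TangentSpace I x)]
  {F : Type*} [NormedAddCommGroup F] [NormedSpace ℝ F]
  {E : M → Type*} [TopologicalSpace (TotalSpace F E)]
  [∀ x, NormedAddCommGroup (E x)] [∀ x, InnerProductSpace ℝ (E x)]
  [FiberBundle F E]

/-- The derivative of a function on the total space in the vertical directions at `ξ`, which are
identified with the fibre through `ξ`. -/
def verticalDeriv (f : TotalSpace F E → ℝ) (ξ : TotalSpace F E) : E ξ.proj →L[ℝ] ℝ :=
  fderiv ℝ (fun y : E ξ.proj ↦ f ⟨ξ.proj, y⟩) ξ.snd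

/-- The derivative of a function on the total space at `ξ` along the horizontal lift of a vector
tangent to the base. If `σ` is a section with `σ x = ξ`, the horizontal lift of `v` at `ξ` is
`dσ(v)` minus the vertical vector `∇_v σ`. -/
def horizontalDeriv (cov : CovariantDerivative I F E) (f : TotalSpace F E → ℝ)
    (ξ : TotalSpace F E) : TangentSpace I ξ.proj →L[ℝ] ℝ :=
  mvfderiv I (fun x ↦ f ⟨x, FiberBundle.extend F ξ.snd x⟩) ξ.proj
    - (verticalDeriv f ξ).comp (cov (FiberBundle.extend F ξ.snd) ξ.proj)

/-- The differential of `f` at `ξ`. The vector `(v, s)` of `T_x M × E_x` stands for the vector of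
`T_ξ E` with horizontal part the lift of `v` and with vertical part `s`. -/
def sasakiDeriv (cov : CovariantDerivative I F E) (f : TotalSpace F E → ℝ)
    (ξ : TotalSpace F E) (A : TangentSpace I ξ.proj × E ξ.proj) : ℝ :=
  horizontalDeriv cov f ξ A.1 + verticalDeriv f ξ A.2

/-- The norm of the gradient of `f` for the metric `G` on the total space for which the horizontal
and vertical distributions are orthogonal, `π` is a Riemannian submersion and the fibres carry
their given inner product. -/
def sasakiGradNorm (cov : CovariantDerivative I F E) (f : TotalSpace F E → ℝ)
    (ξ : TotalSpace F E) : ℝ :=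
  √(‖horizontalDeriv cov f ξ‖ ^ 2 + ‖verticalDeriv f ξ‖ ^ 2)

/-- The second covariant derivative `D²f(A, B) = A(B f) - (D_A B) f` of `f` at `ξ` for the Sasaki
connection `D`. For vector fields `X`, `Y` on the base and sections `s`, `t`, with horizontal lifts
`Xʰ`, `Yʰ` and vertical lifts `sᵛ`, `tᵛ`, this connection is given by
`D_{Xʰ} Yʰ = (∇_X Y)ʰ`, `D_{Xʰ} tᵛ = (∇_X t)ᵛ`, `D_{sᵛ} Yʰ = 0`, `D_{sᵛ} tᵛ = 0`.
The four summands are the horizontal-horizontal, the horizontal-vertical, the vertical-horizontal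
and the vertical-vertical part. -/
def sasakiHessian (cov : CovariantDerivative I F E) (f : TotalSpace F E → ℝ)
    (ξ : TotalSpace F E) (A B : TangentSpace I ξ.proj × E ξ.proj) : ℝ :=
  let X : Π x : M, TangentSpace I x := FiberBundle.extend EM A.1
  let Y : Π x : M, TangentSpace I x := FiberBundle.extend EM B.1
  let t : Π x : M, E x := FiberBundle.extend F B.2
  (horizontalDeriv cov (fun η ↦ horizontalDeriv cov f η (Y η.proj)) ξ A.1
      - horizontalDeriv cov f ξ (leviCivita I X Y ξ.proj))
    + (horizontalDeriv cov (fun η ↦ verticalDeriv f η (t η.proj)) ξ A.1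
      - verticalDeriv f ξ (cov t ξ.proj A.1))
    + verticalDeriv (fun η ↦ horizontalDeriv cov f η (Y η.proj)) ξ A.2
    + verticalDeriv (fun η ↦ verticalDeriv f η (t η.proj)) ξ A.2

/-- The second fundamental form `G(D_A N, B) = D²f(A, B) / |grad f|` at `ξ` of the level
hypersurface of `f`, with unit normal `N = grad f / |grad f|`, for vectors `A`, `B` tangent to it. -/
def sasakiSecondFundamentalForm (cov : CovariantDerivative I F E) (f : TotalSpace F E → ℝ)
    (ξ : TotalSpace F E) (A B : TangentSpace I ξ.proj × E ξ.proj) : ℝ :=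
  sasakiHessian cov f ξ A B / sasakiGradNorm cov f ξ

end Sasaki

/-! ### Radial graphs over the unit sphere bundle -/

section RadialGraph

variable {M : Type*} (F : Type*) (E : M → Type*)
  [∀ x, NormedAddCommGroup (E x)] [∀ x, InnerProductSpace ℝ (E x)]

/-- The bundle with its zero section removed. -/
def puncturedBundle : Set (TotalSpace F E) := {ξ | ξ.snd ≠ 0}

/-- The unit sphere bundle. -/
def unitSphereBundle : Set (TotalSpace F E) := {ξ | ‖ξ.snd‖ = 1}

variable {F E}

/-- Multiplication by a scalar in the fibres. -/
def dilate (c : ℝ) (ξ : TotalSpace F E) : TotalSpace F E := ⟨ξ.proj, c • ξ.snd⟩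

theorem norm_dilate (c : ℝ) (ξ : TotalSpace F E) : ‖(dilate c ξ).snd‖ = |c| * ‖ξ.snd‖ :=
  norm_smul c ξ.snd

theorem dilate_dilate (c d : ℝ) (ξ : TotalSpace F E) :
    dilate c (dilate d ξ) = dilate (c * d) ξ :=
  congrArg (TotalSpace.mk ξ.proj) (smul_smul c d ξ.snd)

theorem dilate_one (ξ : TotalSpace F E) : dilate 1 ξ = ξ :=
  congrArg (TotalSpace.mk ξ.proj) (one_smul ℝ ξ.snd)

theorem dilate_mem_unitSphereBundle {ξ : TotalSpace F E} (h : ξ ∈ puncturedBundle F E) :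
    dilate ‖ξ.snd‖⁻¹ ξ ∈ unitSphereBundle F E := by
  have h' : ‖ξ.snd‖ ≠ 0 := norm_ne_zero_iff.mpr h
  rw [unitSphereBundle, Set.mem_ofPred_eq, norm_dilate, abs_inv, abs_norm, inv_mul_cancel₀ h']

open Classical in
/-- The radially constant extension to the punctured bundle of a function on the unit sphere
bundle. -/
def radialExtension (u : unitSphereBundle F E → ℝ) (ξ : TotalSpace F E) : ℝ :=
  if h : ξ ∈ puncturedBundle F E then
    u ⟨dilate ‖ξ.snd‖⁻¹ ξ, dilate_mem_unitSphereBundle h⟩ else 0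

end RadialGraph

section Fibre

theorem fibre_finiteDimensional {M : Type*} [TopologicalSpace M]
    (F : Type*) [NormedAddCommGroup F] [NormedSpace ℝ F] [FiniteDimensional ℝ F]
    (E : M → Type*) [TopologicalSpace (TotalSpace F E)]
    [∀ x, NormedAddCommGroup (E x)] [∀ x, InnerProductSpace ℝ (E x)]
    [FiberBundle F E] [VectorBundle ℝ F E] (x : M) : FiniteDimensional ℝ (E x) :=
  (((trivializationAt F E x).continuousLinearEquivAt ℝ x
    (FiberBundle.mem_baseSet_trivializationAt' x)).symm.toLinearEquiv).finiteDimensional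

theorem fibre_completeSpace {M : Type*} [TopologicalSpace M]
    (F : Type*) [NormedAddCommGroup F] [NormedSpace ℝ F] [FiniteDimensional ℝ F]
    (E : M → Type*) [TopologicalSpace (TotalSpace F E)]
    [∀ x, NormedAddCommGroup (E x)] [∀ x, InnerProductSpace ℝ (E x)]
    [FiberBundle F E] [VectorBundle ℝ F E] (x : M) : CompleteSpace (E x) :=
  haveI := fibre_finiteDimensional F E x
  FiniteDimensional.complete ℝ (E x)

end Fibre

section Graph

variable {EM : Type*} [NormedAddCommGroup EM] [NormedSpace ℝ EM]
  {H : Type*} [TopologicalSpace H] (I : ModelWithCorners ℝ EM H)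
  {M : Type*} [TopologicalSpace M] [ChartedSpace H M]
  (F : Type*) [NormedAddCommGroup F] [NormedSpace ℝ F]
  (E : M → Type*) [TopologicalSpace (TotalSpace F E)]
  [∀ x, NormedAddCommGroup (E x)] [∀ x, InnerProductSpace ℝ (E x)]
  [FiberBundle F E]

/-- A smooth radial graph `ξ ↦ exp (u ξ) ξ` over the unit sphere bundle. A function `u` on the unit
sphere bundle is smooth if and only if its radially constant extension is smooth on the punctured
bundle. -/
structure RadialGraph where
  /-- The function `u`. -/
  logRadius : unitSphereBundle F E → ℝ
  smooth : ContMDiffOn (I.prod 𝓘(ℝ, F)) 𝓘(ℝ, ℝ) ∞ (radialExtension logRadius) (puncturedBundle F E)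

end Graph

namespace RadialGraph

section Basic

variable {EM : Type*} [NormedAddCommGroup EM] [NormedSpace ℝ EM]
  {H : Type*} [TopologicalSpace H] {I : ModelWithCorners ℝ EM H}
  {M : Type*} [TopologicalSpace M] [ChartedSpace H M]
  {F : Type*} [NormedAddCommGroup F] [NormedSpace ℝ F]
  {E : M → Type*} [TopologicalSpace (TotalSpace F E)]
  [∀ x, NormedAddCommGroup (E x)] [∀ x, InnerProductSpace ℝ (E x)]
  [FiberBundle F E]

/-- The underlying hypersurface. -/
def carrier (Y : RadialGraph I F E) : Set (TotalSpace F E) :=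
  Set.range fun ξ : unitSphereBundle F E ↦ dilate (Real.exp (Y.logRadius ξ)) (ξ : TotalSpace F E)

/-- The function `‖ξ‖ exp (-u ξ)`, with `u` radially constant. It increases outwards and the graph
is its level hypersurface of value `1`. -/
def definingFunction (Y : RadialGraph I F E) (ξ : TotalSpace F E) : ℝ :=
  ‖ξ.snd‖ * Real.exp (-radialExtension Y.logRadius ξ)

theorem carrier_eq (Y : RadialGraph I F E) :
    Y.carrier = {ξ | ξ ∈ puncturedBundle F E ∧ Y.definingFunction ξ = 1} := by
  ext η
  constructor
  · rintro ⟨ξ, rfl⟩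
    have hξ : ‖(ξ : TotalSpace F E).snd‖ = 1 := ξ.2
    have h0 : (ξ : TotalSpace F E).snd ≠ 0 := by
      intro h
      simp [h] at hξ
    have hmem : dilate (Real.exp (Y.logRadius ξ)) (ξ : TotalSpace F E) ∈ puncturedBundle F E :=
      smul_ne_zero (Real.exp_ne_zero _) h0
    have hu : radialExtension Y.logRadius (dilate (Real.exp (Y.logRadius ξ)) (ξ : TotalSpace F E))
        = Y.logRadius ξ := by
      rw [radialExtension, dif_pos hmem]
      congr 1
      apply Subtype.ext
      change dilate _ (dilate _ _) = _
      rw [norm_dilate, hξ, mul_one, Real.abs_exp, dilate_dilate,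
        inv_mul_cancel₀ (Real.exp_ne_zero _), dilate_one]
    refine ⟨hmem, ?_⟩
    rw [definingFunction, hu]
    rw [norm_dilate, hξ, mul_one, Real.abs_exp, ← Real.exp_add, add_neg_cancel, Real.exp_zero]
  · rintro ⟨hη, h1⟩
    have h0 : ‖η.snd‖ ≠ 0 := norm_ne_zero_iff.mpr hη
    refine ⟨⟨dilate ‖η.snd‖⁻¹ η, dilate_mem_unitSphereBundle hη⟩, ?_⟩
    rw [definingFunction, radialExtension, dif_pos hη, Real.exp_neg,
      mul_inv_eq_one₀ (Real.exp_ne_zero _)] at h1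
    change dilate (Real.exp _) (dilate _ η) = η
    rw [← h1, dilate_dilate, mul_inv_cancel₀ h0, dilate_one]

/-- Two radial graphs are homothetic if one is the image of the other under a dilation. -/
def Homothetic (Y Z : RadialGraph I F E) : Prop :=
  ∃ c : ℝ, 0 < c ∧ Z.carrier = dilate c '' Y.carrier

end Basic

section Curvature

variable {EM : Type*} [NormedAddCommGroup EM] [NormedSpace ℝ EM]
  {H : Type*} [TopologicalSpace H] {I : ModelWithCorners ℝ EM H}
  {M : Type*} [TopologicalSpace M] [ChartedSpace H M]
  {F : Type*} [NormedAddCommGroup F] [NormedSpace ℝ F] [FiniteDimensional ℝ F]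
  {E : M → Type*} [TopologicalSpace (TotalSpace F E)]
  [∀ x, NormedAddCommGroup (E x)] [∀ x, InnerProductSpace ℝ (E x)]
  [FiberBundle F E] [VectorBundle ℝ F E]

/-- The vertical Gaussian curvature at a point `ξ` of the graph: the Gaussian curvature at `ξ` of
the part of the graph in the fibre through `ξ`, as a hypersurface of this Euclidean space. -/
def verticalGaussCurvature (Y : RadialGraph I F E) (ξ : TotalSpace F E) : ℝ :=
  haveI : CompleteSpace (E ξ.proj) := fibre_completeSpace F E ξ.proj
  gaussCurvature (fun y : E ξ.proj ↦ Y.definingFunction ⟨ξ.proj, y⟩) ξ.snd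

/-- The vertical Gaussian curvature of the graph is given by `K`. -/
def HasVerticalGaussCurvature (Y : RadialGraph I F E) (K : TotalSpace F E → ℝ) : Prop :=
  ∀ ξ ∈ Y.carrier, Y.verticalGaussCurvature ξ = K ξ

end Curvature

section Convex

variable {EM : Type*} [NormedAddCommGroup EM] [NormedSpace ℝ EM] [FiniteDimensional ℝ EM]
  {H : Type*} [TopologicalSpace H] {I : ModelWithCorners ℝ EM H}
  {M : Type*} [TopologicalSpace M] [ChartedSpace H M] [IsManifold I ∞ M]
  [RiemannianBundle (fun x : M ↦ TangentSpace I x)]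
  {F : Type*} [NormedAddCommGroup F] [NormedSpace ℝ F]
  {E : M → Type*} [TopologicalSpace (TotalSpace F E)]
  [∀ x, NormedAddCommGroup (E x)] [∀ x, InnerProductSpace ℝ (E x)]
  [FiberBundle F E]

/-- A radial graph is convex if its second fundamental form with respect to the Sasaki connection
and the outward unit normal is positive semidefinite at each of its points. -/
def IsConvex (cov : CovariantDerivative I F E) (Y : RadialGraph I F E) : Prop :=
  ∀ ξ ∈ Y.carrier, ∀ A : TangentSpace I ξ.proj × E ξ.proj,
    sasakiDeriv cov Y.definingFunction ξ A = 0 →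
      0 ≤ sasakiSecondFundamentalForm cov Y.definingFunction ξ A A

end Convex

end RadialGraph

end

noncomputable section

/-! ### Second derivative test and homogeneous maps -/

section Calculus

open Topology Filter

/-! A radial graph is the level set `f = 1` of a function that restricts in each fibre to a gauge:
smooth and positive off the origin, homogeneous of degree one. The sphere bundle of radius `r` has
`f = ‖ξ‖ / r`, vertical curvature `r ^ (1 - m)` and a nonnegative Hessian, which gives (1).

The core is a rigidity statement in one fibre, `IsSmoothGauge.eq_const_mul_norm`: if at every point
`p` of `f = 1` the curvature is at least `‖p‖ ^ (1 - m)`, then `f` is a multiple of the norm. Let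
`ν` be the Gauss map. The Hessian of `f² / 2` is nondegenerate because the curvature does not
vanish, and it is positive definite at the point farthest from the origin. The complement of the
origin is connected, so it is positive definite everywhere. Hence `y ↦ ‖y‖ ν(y)` is injective; it
preserves norms, and its Jacobian is at least `‖y‖ / ⟨ν, y⟩ ≥ 1`. It maps the punctured unit ball
into itself, so comparing volumes forces `⟨ν, y⟩ = ‖y‖`. Thus `ν` is radial and `f / ‖y‖` is
constant.

For (2), write `K` as `k ‖ξ‖` and look at one fibre. If `k r ≥ r ^ (1 - m)` for all `r`, rigidity
makes that part of the graph a sphere, whose radius solves the equation. Otherwise the inequality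
fails at some radius but holds at the largest distance of the graph from the origin, and the
intermediate value theorem applies.

For (3), every graph with `f = h(x) ‖ξ‖`, `h` smooth and positive, has the required curvature; radii
`exp (i w)` with `w` nonconstant give infinitely many homothety classes. Conversely rigidity puts
every solution in this form. Convexity, tested on suitable tangent vectors, yields `Hess h ≥ 2 dh² /
h ≥ 0`, and a convex function on a connected closed manifold is constant (`eq_of_hessian_nonneg`).
So convex solutions are sphere bundles of constant radius. -/

theorem deriv_deriv_nonneg_of_isLocalMin {q : ℝ → ℝ} {a : ℝ} (h : IsLocalMin q a)
    (hq : ContinuousAt q a) : 0 ≤ deriv (deriv q) a := by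
  by_contra! hneg
  -- Now `a` is both a local minimum and a local maximum, so `q` is constant near `a` and its second
  -- derivative there is `0`.
  have hmax := isLocalMax_of_deriv_deriv_neg hneg h.deriv_eq_zero hq
  have heq : q =ᶠ[𝓝 a] fun _ ↦ q a := by
    filter_upwards [h, hmax] with x h1 h2 using le_antisymm h2 h1
  have := heq.deriv.deriv_eq
  simp only [deriv_const', deriv_const] at this
  exact hneg.ne this

/-- The second derivative test along a line or curve, with the derivatives named. -/
theorem second_deriv_nonneg_of_isLocalMin {q q' : ℝ → ℝ} {a b : ℝ} (h : IsLocalMin q a)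
    (hq : ∀ᶠ t in 𝓝 a, HasDerivAt q (q' t) t) (hq' : HasDerivAt q' b a) : 0 ≤ b := by
  have h1 := deriv_deriv_nonneg_of_isLocalMin h hq.self_of_nhds.continuousAt
  have h2 : deriv q =ᶠ[𝓝 a] q' := hq.mono fun t ht ↦ ht.deriv
  rwa [h2.deriv_eq, hq'.deriv] at h1

variable {V : Type*} [NormedAddCommGroup V] [NormedSpace ℝ V]
  {W : Type*} [NormedAddCommGroup W] [NormedSpace ℝ W]

theorem hasDerivAt_comp_smul_one {h : V → W} {p : V} (hd : DifferentiableAt ℝ h p) :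
    HasDerivAt (fun t : ℝ ↦ h (t • p)) (fderiv ℝ h p p) 1 := by
  have h1 : HasDerivAt (fun t : ℝ ↦ t • p) p 1 := by
    simpa using (hasDerivAt_id (1 : ℝ)).smul_const p
  have h2 : HasFDerivAt h (fderiv ℝ h p) ((1 : ℝ) • p) := by simpa using hd.hasFDerivAt
  exact h2.comp_hasDerivAt 1 h1

theorem fderiv_self_of_homogeneous_zero {h : V → W} {p : V} (hd : DifferentiableAt ℝ h p)
    (hom : ∀ c : ℝ, 0 < c → h (c • p) = h p) : fderiv ℝ h p p = 0 := by
  have h1 : HasDerivAt (fun t : ℝ ↦ h (t • p)) 0 1 := by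
    refine (hasDerivAt_const (1 : ℝ) (h p)).congr_of_eventuallyEq ?_
    filter_upwards [lt_mem_nhds (zero_lt_one' ℝ)] with t ht using hom t ht
  exact (hasDerivAt_comp_smul_one hd).unique h1

theorem fderiv_self_of_homogeneous_one {h : V → W} {p : V} (hd : DifferentiableAt ℝ h p)
    (hom : ∀ c : ℝ, 0 < c → h (c • p) = c • h p) : fderiv ℝ h p p = h p := by
  have h1 : HasDerivAt (fun t : ℝ ↦ h (t • p)) (h p) 1 := by
    have : HasDerivAt (fun t : ℝ ↦ t • h p) (h p) 1 := by
      simpa using (hasDerivAt_id (1 : ℝ)).smul_const (h p)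
    refine this.congr_of_eventuallyEq ?_
    filter_upwards [lt_mem_nhds (zero_lt_one' ℝ)] with t ht using hom t ht
  exact (hasDerivAt_comp_smul_one hd).unique h1

/-- The derivative of a map which is positively homogeneous of degree one is positively homogeneous
of degree zero. -/
theorem fderiv_smul_of_homogeneous_one {h : V → W}
    (hd : ∀ p ≠ 0, DifferentiableAt ℝ h p)
    (hom : ∀ c : ℝ, 0 < c → ∀ p ≠ 0, h (c • p) = c • h p) {c : ℝ} (hc : 0 < c) {p : V}
    (hp : p ≠ 0) : fderiv ℝ h (c • p) = fderiv ℝ h p := by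
  have hcp : c • p ≠ 0 := smul_ne_zero hc.ne' hp
  have h1 : HasFDerivAt (fun y : V ↦ c • y) (c • ContinuousLinearMap.id ℝ V) p :=
    (hasFDerivAt_id p).const_smul c
  have h2 := (hd _ hcp).hasFDerivAt.comp p h1
  have h3 : HasFDerivAt (fun y ↦ h (c • y)) (c • fderiv ℝ h p) p := by
    refine ((hd p hp).hasFDerivAt.const_smul c).congr_of_eventuallyEq ?_
    filter_upwards [isOpen_compl_singleton.mem_nhds hp] with y hy using hom c hc y hy
  have h4 := h2.unique h3
  ext v
  have h5 := congrArg (fun L : V →L[ℝ] W ↦ L v) h4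
  simp only [ContinuousLinearMap.comp_apply, smul_apply,
    ContinuousLinearMap.id_apply, map_smul] at h5
  exact smul_right_injective W hc.ne' h5

end Calculus

/-! ### Linear algebra -/

section LinearAlgebra

variable {V : Type*} [NormedAddCommGroup V] [InnerProductSpace ℝ V]

/-- A positive semidefinite symmetric operator kills its isotropic vectors. -/
theorem eq_zero_of_inner_self_eq_zero_of_nonneg {B : V →L[ℝ] V}
    (hB : ∀ v w, inner ℝ (B v) w = inner ℝ v (B w)) (hpos : ∀ v, 0 ≤ inner ℝ (B v) v) {v : V}
    (hv : inner ℝ (B v) v = 0) : B v = 0 := by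
  set w := B v with hw
  by_contra hne
  have hn : 0 < ‖w‖ ^ 2 := by positivity
  have key : ∀ s : ℝ, 0 ≤ 2 * s * ‖w‖ ^ 2 + s ^ 2 * inner ℝ (B w) w := by
    intro s
    have h1 := hpos (v + s • w)
    have h2 : inner ℝ (B w) v = ‖w‖ ^ 2 := by rw [hB, ← hw, real_inner_self_eq_norm_sq]
    simp only [map_add, map_smul, inner_add_left, inner_add_right, real_inner_smul_left,
      real_inner_smul_right, ← hw, real_inner_self_eq_norm_sq, h2] at h1
    rw [hv] at h1
    nlinarith
  have hb := hpos w
  set b := inner ℝ (B w) w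
  -- The quadratic in `key` is negative for small negative `s`. The value used is nearly its
  -- minimiser; `b + 1` in place of `b` also covers `b = 0`.
  have h3 := key (-(‖w‖ ^ 2 / (b + 1)))
  have hb1 : 0 < b + 1 := by linarith
  have h4 : 2 * -(‖w‖ ^ 2 / (b + 1)) * ‖w‖ ^ 2 + (-(‖w‖ ^ 2 / (b + 1))) ^ 2 * b
      = -((‖w‖ ^ 2) ^ 2 * (b + 2) / (b + 1) ^ 2) := by
    field_simp
    ring
  rw [h4] at h3
  have : 0 < (‖w‖ ^ 2) ^ 2 * (b + 2) / (b + 1) ^ 2 := by positivity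
  linarith

variable [FiniteDimensional ℝ V]

/-- A symmetric operator bounded below by `c ≥ 0` has determinant at least `c ^ dim V`. -/
theorem LinearMap.IsSymmetric.pow_le_det {S : V →ₗ[ℝ] V} (hS : S.IsSymmetric) {c : ℝ} (hc : 0 ≤ c)
    (h : ∀ v, c * ‖v‖ ^ 2 ≤ inner ℝ (S v) v) : c ^ Module.finrank ℝ V ≤ LinearMap.det S := by
  rw [hS.det_eq_prod_eigenvalues rfl]
  have : ∀ i, c ≤ hS.eigenvalues rfl i := by
    intro i
    have h1 := h (hS.eigenvectorBasis rfl i)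
    rw [hS.apply_eigenvectorBasis rfl i] at h1
    simpa [inner_smul_left] using h1
  calc c ^ Module.finrank ℝ V = ∏ _i : Fin (Module.finrank ℝ V), c := by simp
    _ ≤ _ := Finset.prod_le_prod (fun _ _ ↦ hc) fun i _ ↦ this i

/-- If `D` maps into the hyperplane orthogonal to `g`, then the determinant of its restriction to
the hyperplane is that of `D` plus the orthogonal projection onto the line spanned by `g`. -/
theorem det_restrict_orthogonal {g ν : V} (hg : g ≠ 0) (hν : ν = ‖g‖⁻¹ • g) (D : V →ₗ[ℝ] V)
    (hD : ∀ v, inner ℝ g (D v) = 0) :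
    LinearMap.det (((Submodule.span ℝ {g})ᗮ.orthogonalProjectionOnto.toLinearMap ∘ₗ D) ∘ₗ
      (Submodule.span ℝ {g})ᗮ.subtype) =
    LinearMap.det (D + (innerₗ V ν).smulRight ν) := by
  set T := (Submodule.span ℝ {g})ᗮ with hT
  have memT : ∀ v, v ∈ T ↔ inner ℝ g v = 0 := fun v ↦
    Submodule.mem_orthogonal_singleton_iff_inner_right
  have hgn : ‖g‖ ≠ 0 := norm_ne_zero_iff.mpr hg
  have hνν : inner ℝ ν ν = 1 := by
    rw [hν, real_inner_smul_left, real_inner_smul_right, real_inner_self_eq_norm_sq]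
    field_simp
  have hgν : ∀ v, inner ℝ ν v = ‖g‖⁻¹ * inner ℝ g v := fun v ↦ by rw [hν, real_inner_smul_left]
  have inv : T ≤ T.comap (D + (innerₗ V ν).smulRight ν) := by
    intro v hv
    rw [memT] at hv
    simp [memT, hD, hgν, hv]
  -- The operator is block triangular for `T`: it restricts to `D` on `T`, and on the quotient line
  -- it is the identity, since modulo `T` only the projection onto `ν` survives.
  rw [LinearMap.det_eq_det_mul_det T _ inv]
  have h1 : T.mapQ T (D + (innerₗ V ν).smulRight ν) inv = LinearMap.id := by
    ext v
    simp only [LinearMap.comp_apply, Submodule.mkQ_apply, Submodule.mapQ_apply, LinearMap.id_apply]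
    rw [Submodule.Quotient.eq, memT]
    have : inner ℝ g ν = ‖g‖ := by
      rw [hν, real_inner_smul_right, real_inner_self_eq_norm_sq]
      field_simp
    simp only [LinearMap.add_apply, LinearMap.smulRight_apply, innerₗ_apply_apply, inner_sub_right,
      inner_add_right, hD, real_inner_smul_right, this, hgν]
    field_simp
    ring
  rw [h1, LinearMap.det_id, mul_one]
  congr 1
  ext v
  have hv : inner ℝ g (v : V) = 0 := (memT _).1 v.2
  have hDv : D v ∈ T := (memT _).2 (hD _)
  simp only [LinearMap.comp_apply, Submodule.subtype_apply, ContinuousLinearMap.coe_coe,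
    LinearMap.coe_restrict_apply, LinearMap.add_apply, LinearMap.smulRight_apply,
    innerₗ_apply_apply, hgν, hv, mul_zero, zero_smul, add_zero]
  exact Submodule.starProjection_eq_self_iff.mpr hDv

/-- The determinant of the differential of `y ↦ ‖y‖ ν(y)`, for a unit field `ν` homogeneous of
degree zero with differential `D`. -/
theorem det_radial_map {g ν y : V} (hg : g ≠ 0) (hν : ν = ‖g‖⁻¹ • g) (D : V →ₗ[ℝ] V)
    (hD : ∀ v, inner ℝ g (D v) = 0) (hy : y ≠ 0) (hDy : D y = 0) (ha : inner ℝ ν y ≠ 0) :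
    LinearMap.det (‖y‖ • D + (‖y‖⁻¹ • innerₗ V y).smulRight ν) =
      ‖y‖ ^ Module.finrank ℝ V * (inner ℝ ν y)⁻¹ *
      LinearMap.det (((Submodule.span ℝ {g})ᗮ.orthogonalProjectionOnto.toLinearMap ∘ₗ D) ∘ₗ
        (Submodule.span ℝ {g})ᗮ.subtype) := by
  have hyn : ‖y‖ ≠ 0 := norm_ne_zero_iff.mpr hy
  rw [det_restrict_orthogonal hg hν D hD]
  set a := inner ℝ ν y
  -- As `D y = 0`, a shear along `y` leaves `D` unchanged; this one turns the functional `⟨ν, ·⟩`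
  -- into `⟨y, ·⟩ / ‖y‖²`. Its determinant is `a⁻¹`.
  have key : ‖y‖ • D + (‖y‖⁻¹ • innerₗ V y).smulRight ν =
      ‖y‖ • ((D + (innerₗ V ν).smulRight ν) ∘ₗ
        LinearMap.transvection ((‖y‖ ^ 2)⁻¹ • innerₗ V y - innerₗ V ν) (a⁻¹ • y)) := by
    ext v
    simp only [LinearMap.add_apply, LinearMap.smul_apply, LinearMap.smulRight_apply,
      LinearMap.comp_apply, LinearMap.transvection.apply, innerₗ_apply_apply, LinearMap.sub_apply,
      map_add, map_smul, hDy, smul_zero, smul_eq_mul, smul_add, smul_smul]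
    rw [show inner ℝ ν y = a from rfl]
    rw [add_assoc, add_right_inj, zero_add, ← add_smul]
    congr 1
    field_simp
    ring
  rw [key, LinearMap.det_smul, LinearMap.det_comp, LinearMap.transvection.det]
  simp only [LinearMap.sub_apply, LinearMap.smul_apply, innerₗ_apply_apply, map_smul, smul_eq_mul,
    real_inner_self_eq_norm_sq]
  rw [show inner ℝ ν y = a from rfl]
  have : 1 + a⁻¹ * ((‖y‖ ^ 2)⁻¹ * ‖y‖ ^ 2 - a) = a⁻¹ := by
    field_simp
    ring
  rw [this]
  ring

end LinearAlgebra

/-! ### Smooth gauges of a Euclidean space -/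

/-- A function which is smooth and positive off the origin and positively homogeneous of degree
one. Its level hypersurfaces are the radial graphs over the unit sphere. -/
structure IsSmoothGauge {V : Type*} [NormedAddCommGroup V] [NormedSpace ℝ V] (f : V → ℝ) :
    Prop where
  contDiffOn : ContDiffOn ℝ ∞ f {0}ᶜ
  pos : ∀ p ≠ 0, 0 < f p
  homog : ∀ c : ℝ, 0 < c → ∀ p ≠ 0, f (c • p) = c * f p

namespace IsSmoothGauge

open Topology Filter

variable {V : Type*} [NormedAddCommGroup V] [InnerProductSpace ℝ V]

theorem _root_.mem_levelTangent_iff [CompleteSpace V] {f : V → ℝ} {p : V} (v : V) :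
    v ∈ levelTangent f p ↔ inner ℝ (gradient f p) v = 0 :=
  Submodule.mem_orthogonal_singleton_iff_inner_right

theorem contDiffAt {f : V → ℝ} (hf : IsSmoothGauge f) {p : V} (hp : p ≠ 0) : ContDiffAt ℝ ∞ f p :=
  hf.contDiffOn.contDiffAt (isOpen_compl_singleton.mem_nhds hp)

theorem differentiableAt {f : V → ℝ} (hf : IsSmoothGauge f) {p : V} (hp : p ≠ 0) :
    DifferentiableAt ℝ f p :=
  (hf.contDiffAt hp).differentiableAt (by simp)

/-! ### Euler's relations and the Hessian of a gauge. -/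

section Complete

variable [CompleteSpace V] {f : V → ℝ} (hf : IsSmoothGauge f) {p : V}

include hf

theorem contDiffAt_gradient (hp : p ≠ 0) : ContDiffAt ℝ ∞ (gradient f) p :=
  (InnerProductSpace.toDual ℝ V).symm.toContinuousLinearEquiv.contDiff.contDiffAt.comp p
    ((hf.contDiffAt hp).fderiv_right (m := ∞) (by simp))

theorem differentiableAt_gradient (hp : p ≠ 0) : DifferentiableAt ℝ (gradient f) p :=
  (hf.contDiffAt_gradient hp).differentiableAt (by simp)

theorem inner_gradient_self (hp : p ≠ 0) : inner ℝ (gradient f p) p = f p := by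
  rw [inner_gradient_left, fderiv_self_of_homogeneous_one (hf.differentiableAt hp)
    fun c hc ↦ by simpa using hf.homog c hc p hp]

theorem gradient_ne_zero (hp : p ≠ 0) : gradient f p ≠ 0 := by
  intro h
  have := hf.inner_gradient_self hp
  rw [h, inner_zero_left] at this
  exact (hf.pos p hp).ne this

theorem norm_gradient_pos (hp : p ≠ 0) : 0 < ‖gradient f p‖ :=
  norm_pos_iff.mpr (hf.gradient_ne_zero hp)

theorem gradient_smul {c : ℝ} (hc : 0 < c) (hp : p ≠ 0) :
    gradient f (c • p) = gradient f p := by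
  rw [gradient, gradient, fderiv_smul_of_homogeneous_one (fun q hq ↦ hf.differentiableAt hq)
    (fun c hc q hq ↦ by simpa using hf.homog c hc q hq) hc hp]

theorem fderiv_gradient_self (hp : p ≠ 0) : fderiv ℝ (gradient f) p p = 0 :=
  fderiv_self_of_homogeneous_zero (hf.differentiableAt_gradient hp)
    fun _ hc ↦ hf.gradient_smul hc hp

theorem inner_fderiv_gradient (hp : p ≠ 0) (v w : V) :
    inner ℝ (fderiv ℝ (gradient f) p v) w = fderiv ℝ (fderiv ℝ f) p v w := by
  have h1 : DifferentiableAt ℝ (fderiv ℝ f) p :=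
    ((hf.contDiffAt hp).fderiv_right (m := ∞) (by simp)).differentiableAt (by simp)
  have h2 : HasFDerivAt (gradient f)
      ((InnerProductSpace.toDual ℝ V).symm.toContinuousLinearEquiv.toContinuousLinearMap ∘L
        fderiv ℝ (fderiv ℝ f) p) p :=
    ((InnerProductSpace.toDual ℝ V).symm.toContinuousLinearEquiv.hasFDerivAt).comp p
      h1.hasFDerivAt
  rw [h2.fderiv]
  exact InnerProductSpace.toDual_symm_apply

theorem inner_fderiv_gradient_comm (hp : p ≠ 0) (v w : V) :
    inner ℝ (fderiv ℝ (gradient f) p v) w = inner ℝ v (fderiv ℝ (gradient f) p w) := by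
  rw [real_inner_comm (fderiv ℝ (gradient f) p w) v, hf.inner_fderiv_gradient hp,
    hf.inner_fderiv_gradient hp]
  exact (hf.contDiffAt hp).isSymmSndFDerivAt
    (by simpa using! (ENat.LEInfty.out : (2 : WithTop ℕ∞) ≤ ∞)) v w

/-! #### The Gauss map -/

theorem norm_gaussMap (hp : p ≠ 0) : ‖gaussMap f p‖ = 1 := by
  rw [gaussMap, norm_smul, norm_inv, norm_norm, inv_mul_cancel₀ (hf.norm_gradient_pos hp).ne']

theorem gradient_eq_smul_gaussMap (hp : p ≠ 0) :
    gradient f p = ‖gradient f p‖ • gaussMap f p := by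
  rw [gaussMap, smul_smul, mul_inv_cancel₀ (hf.norm_gradient_pos hp).ne', one_smul]

theorem inner_gaussMap_self (hp : p ≠ 0) :
    inner ℝ (gaussMap f p) p = f p / ‖gradient f p‖ := by
  rw [gaussMap, real_inner_smul_left, hf.inner_gradient_self hp, inv_mul_eq_div]

theorem inner_gaussMap_self_pos (hp : p ≠ 0) : 0 < inner ℝ (gaussMap f p) p := by
  rw [hf.inner_gaussMap_self hp]
  exact div_pos (hf.pos p hp) (hf.norm_gradient_pos hp)

theorem gaussMap_smul {c : ℝ} (hc : 0 < c) (hp : p ≠ 0) :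
    gaussMap f (c • p) = gaussMap f p := by
  rw [gaussMap, gaussMap, hf.gradient_smul hc hp]

theorem contDiffAt_gaussMap (hp : p ≠ 0) : ContDiffAt ℝ ∞ (gaussMap f) p :=
  (((contDiffAt_norm ℝ (hf.gradient_ne_zero hp)).comp p (hf.contDiffAt_gradient hp)).inv
    (hf.norm_gradient_pos hp).ne').smul (hf.contDiffAt_gradient hp)

theorem differentiableAt_gaussMap (hp : p ≠ 0) : DifferentiableAt ℝ (gaussMap f) p :=
  (hf.contDiffAt_gaussMap hp).differentiableAt (by simp)

theorem fderiv_gaussMap_self (hp : p ≠ 0) : fderiv ℝ (gaussMap f) p p = 0 :=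
  fderiv_self_of_homogeneous_zero (hf.differentiableAt_gaussMap hp)
    fun _ hc ↦ hf.gaussMap_smul hc hp

theorem inner_gradient_fderiv_gaussMap (hp : p ≠ 0) (v : V) :
    inner ℝ (gradient f p) (fderiv ℝ (gaussMap f) p v) = 0 := by
  have h1 := (hf.differentiableAt_gaussMap hp).hasFDerivAt
  have h2 := h1.inner ℝ h1
  have h3 : HasFDerivAt (fun q ↦ inner ℝ (gaussMap f q) (gaussMap f q)) (0 : V →L[ℝ] ℝ) p := by
    refine (hasFDerivAt_const (1 : ℝ) p).congr_of_eventuallyEq ?_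
    filter_upwards [isOpen_compl_singleton.mem_nhds hp] with q hq
    rw [real_inner_self_eq_norm_sq, hf.norm_gaussMap hq, one_pow]
  have h4 := congrArg (fun L : V →L[ℝ] ℝ ↦ L v) (h2.unique h3)
  simp only [ContinuousLinearMap.comp_apply, ContinuousLinearMap.prod_apply,
    fderivInnerCLM_apply, zero_apply] at h4
  rw [real_inner_comm (gaussMap f p) (fderiv ℝ (gaussMap f) p v)] at h4
  rw [hf.gradient_eq_smul_gaussMap hp, real_inner_smul_left]
  have : inner ℝ (gaussMap f p) (fderiv ℝ (gaussMap f) p v) = 0 := by linarith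
  rw [this, mul_zero]

/-- Differentiating the normalising factor only adds a multiple of the gradient, to which `w` is
orthogonal. -/
theorem inner_fderiv_gaussMap (hp : p ≠ 0) (v : V) {w : V} (hw : inner ℝ (gradient f p) w = 0) :
    inner ℝ (fderiv ℝ (gaussMap f) p v) w =
      ‖gradient f p‖⁻¹ * inner ℝ (fderiv ℝ (gradient f) p v) w := by
  have h1 : DifferentiableAt ℝ (fun q ↦ ‖gradient f q‖⁻¹) p :=
    ((((contDiffAt_norm ℝ (hf.gradient_ne_zero hp)).comp p (hf.contDiffAt_gradient hp)).inv
      (hf.norm_gradient_pos hp).ne').of_le (n := ∞) le_rfl).differentiableAt (by simp)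
  have h2 := h1.hasFDerivAt.smul (hf.differentiableAt_gradient hp).hasFDerivAt
  have h3 : fderiv ℝ (gaussMap f) p = _ := h2.fderiv
  rw [h3]
  simp [inner_add_left, real_inner_smul_left, hw]

/-- The derivative of a unit field is orthogonal to it, so the projection in `shapeOperator` does
nothing. -/
theorem coe_shapeOperator (hp : p ≠ 0) (t : levelTangent f p) :
    (shapeOperator f p t : V) = fderiv ℝ (gaussMap f) p t :=
  Submodule.starProjection_eq_self_iff.mpr
    ((mem_levelTangent_iff _).2 (hf.inner_gradient_fderiv_gaussMap hp _))

theorem inner_shapeOperator (hp : p ≠ 0) (t s : levelTangent f p) :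
    inner ℝ (shapeOperator f p t) s =
      ‖gradient f p‖⁻¹ * inner ℝ (fderiv ℝ (gradient f) p t) (s : V) := by
  rw [Submodule.coe_inner, hf.coe_shapeOperator hp,
    hf.inner_fderiv_gaussMap hp _ ((mem_levelTangent_iff _).1 s.2)]

theorem isSymmetric_shapeOperator (hp : p ≠ 0) : (shapeOperator f p).IsSymmetric := by
  intro t s
  rw [hf.inner_shapeOperator hp, real_inner_comm _ t, hf.inner_shapeOperator hp,
    hf.inner_fderiv_gradient_comm hp, real_inner_comm]

/-! #### The differential of half the square of a gauge -/

theorem hasFDerivAt_smul_gradient (hp : p ≠ 0) :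
    HasFDerivAt (fun q ↦ f q • gradient f q)
      (f p • fderiv ℝ (gradient f) p + (fderiv ℝ f p).smulRight (gradient f p)) p :=
  (hf.differentiableAt hp).hasFDerivAt.smul (hf.differentiableAt_gradient hp).hasFDerivAt

/-- This is the Hessian of `f² / 2`. The Hessian of `f` always kills `p`; the rank one term repairs
the radial direction, so that the curvature of the level hypersurface can be studied through a form
on all of `V`. -/
theorem fderiv_smul_gradient_apply (hp : p ≠ 0) (v : V) :
    fderiv ℝ (fun q ↦ f q • gradient f q) p v =
      f p • fderiv ℝ (gradient f) p v + inner ℝ (gradient f p) v • gradient f p := by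
  rw [(hf.hasFDerivAt_smul_gradient hp).fderiv, inner_gradient_left]
  rfl

theorem fderiv_smul_gradient_smul {c : ℝ} (hc : 0 < c) (hp : p ≠ 0) :
    fderiv ℝ (fun q ↦ f q • gradient f q) (c • p) = fderiv ℝ (fun q ↦ f q • gradient f q) p :=
  fderiv_smul_of_homogeneous_one (fun _ hq ↦ (hf.hasFDerivAt_smul_gradient hq).differentiableAt)
    (fun c hc q hq ↦ by rw [hf.homog c hc q hq, hf.gradient_smul hc hq, mul_smul]) hc hp

theorem inner_fderiv_smul_gradient_comm (hp : p ≠ 0) (v w : V) :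
    inner ℝ (fderiv ℝ (fun q ↦ f q • gradient f q) p v) w =
      inner ℝ v (fderiv ℝ (fun q ↦ f q • gradient f q) p w) := by
  rw [hf.fderiv_smul_gradient_apply hp, hf.fderiv_smul_gradient_apply hp, inner_add_left,
    inner_add_right, real_inner_smul_left, real_inner_smul_left, real_inner_smul_right,
    real_inner_smul_right, hf.inner_fderiv_gradient_comm hp, real_inner_comm v]
  ring

theorem continuousOn_fderiv_smul_gradient :
    ContinuousOn (fderiv ℝ fun q ↦ f q • gradient f q) {0}ᶜ := by
  intro q hq
  exact ((((hf.contDiffAt hq).smul (hf.contDiffAt_gradient hq)).fderiv_right (m := ∞)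
    (by simp)).continuousAt).continuousWithinAt

theorem hasDerivAt_half_sq (v : V) {t : ℝ} (ht : p + t • v ≠ 0) :
    HasDerivAt (fun t : ℝ ↦ f (p + t • v) ^ 2 / 2)
      (inner ℝ (f (p + t • v) • gradient f (p + t • v)) v) t := by
  have h1 : HasDerivAt (fun t : ℝ ↦ p + t • v) v t := by
    simpa using ((hasDerivAt_id t).smul_const v).const_add p
  have h2 : HasDerivAt (fun t : ℝ ↦ f (p + t • v)) (fderiv ℝ f (p + t • v) v) t :=
    (hf.differentiableAt ht).hasFDerivAt.comp_hasDerivAt t h1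
  refine ((h2.pow 2).div_const 2).congr_deriv ?_
  rw [real_inner_smul_left, inner_gradient_left]
  push_cast
  ring

theorem hasDerivAt_inner_smul_gradient (v : V) {t : ℝ} (ht : p + t • v ≠ 0) :
    HasDerivAt (fun t : ℝ ↦ inner ℝ (f (p + t • v) • gradient f (p + t • v)) v)
      (inner ℝ (fderiv ℝ (fun q ↦ f q • gradient f q) (p + t • v) v) v) t := by
  have h1 : HasDerivAt (fun t : ℝ ↦ p + t • v) v t := by
    simpa using ((hasDerivAt_id t).smul_const v).const_add p
  have h2 := ((hf.hasFDerivAt_smul_gradient ht).differentiableAt.hasFDerivAt.comp_hasDerivAt t h1)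
  simpa using h2.inner ℝ (hasDerivAt_const t v)

end Complete

end IsSmoothGauge

namespace IsSmoothGauge

open Topology Filter

variable {V : Type*} [NormedAddCommGroup V] [InnerProductSpace ℝ V] [CompleteSpace V]
  {f : V → ℝ}

/-! #### Definiteness -/

/-- Pairing the equation with `p` gives `f p * ⟨grad f, v⟩ = 0`, so `v` is tangent. Then the Hessian
of `f` kills `v`, hence so does the shape operator, whose determinant is nonzero. -/
theorem eq_zero_of_fderiv_smul_gradient_eq_zero [FiniteDimensional ℝ V] (hf : IsSmoothGauge f)
    {p : V} (hp : p ≠ 0) (hK : gaussCurvature f p ≠ 0) {v : V}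
    (hv : fderiv ℝ (fun q ↦ f q • gradient f q) p v = 0) : v = 0 := by
  have h1 : inner ℝ (gradient f p) v = 0 := by
    have h2 : inner ℝ (fderiv ℝ (fun q ↦ f q • gradient f q) p v) p = 0 := by
      rw [hv, inner_zero_left]
    rw [hf.fderiv_smul_gradient_apply hp, inner_add_left, real_inner_smul_left,
      real_inner_smul_left, hf.inner_fderiv_gradient_comm hp, hf.fderiv_gradient_self hp,
      inner_zero_right, hf.inner_gradient_self hp, mul_zero, zero_add] at h2
    exact (mul_eq_zero.1 h2).resolve_right (hf.pos p hp).ne'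
  have h3 : fderiv ℝ (gradient f) p v = 0 := by
    rw [hf.fderiv_smul_gradient_apply hp, h1, zero_smul, add_zero] at hv
    exact (smul_eq_zero.1 hv).resolve_left (hf.pos p hp).ne'
  set t : levelTangent f p := ⟨v, (mem_levelTangent_iff v).2 h1⟩
  have h4 : shapeOperator f p t = 0 := by
    refine ext_inner_right ℝ fun s ↦ ?_
    rw [hf.inner_shapeOperator hp, inner_zero_left]
    change _ * inner ℝ (fderiv ℝ (gradient f) p v) (s : V) = 0
    rw [h3, inner_zero_left, mul_zero]
  have h5 : t = 0 := by
    by_contra hne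
    apply hK
    rw [gaussCurvature, LinearMap.det_eq_zero_iff_ker_ne_bot, Submodule.ne_bot_iff]
    exact ⟨t, h4, hne⟩
  exact congrArg Subtype.val h5

theorem finrank_levelTangent [FiniteDimensional ℝ V] (hf : IsSmoothGauge f) {p : V} (hp : p ≠ 0) :
    Module.finrank ℝ (levelTangent f p) = Module.finrank ℝ V - 1 := by
  have h1 := Submodule.finrank_add_finrank_orthogonal (Submodule.span ℝ {gradient f p})
  rw [finrank_span_singleton (hf.gradient_ne_zero hp)] at h1
  exact Nat.eq_sub_of_add_eq' h1

/-- At a point of a level hypersurface farthest from the origin, the hypersurface is more curved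
than the sphere through that point. -/
theorem exists_inv_norm_pow_le_gaussCurvature [FiniteDimensional ℝ V] [Nontrivial V]
    (hf : IsSmoothGauge f) :
    ∃ p ≠ 0, f p = 1 ∧ ‖p‖⁻¹ ^ (Module.finrank ℝ V - 1) ≤ gaussCurvature f p ∧
      ∀ v ≠ 0, 0 < inner ℝ (fderiv ℝ (fun q ↦ f q • gradient f q) p v) v := by
  obtain ⟨e, he, hmin⟩ := (isCompact_sphere (0 : V) 1).exists_isMinOn
    (NormedSpace.sphere_nonempty.2 zero_le_one)
    (hf.contDiffOn.continuousOn.mono fun q hq ↦ by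
      rintro rfl
      simp at hq)
  have he1 : ‖e‖ = 1 := by simpa using he
  have he0 : e ≠ 0 := by
    rintro rfl
    simp at he1
  set μ := f e
  have hμ : 0 < μ := hf.pos e he0
  have hle : ∀ q, q ≠ 0 → μ * ‖q‖ ≤ f q := by
    intro q hq
    have hqn : 0 < ‖q‖ := norm_pos_iff.mpr hq
    have h1 : μ ≤ f (‖q‖⁻¹ • q) := hmin (by simp [norm_smul, hqn.ne'])
    rw [hf.homog _ (inv_pos.2 hqn) q hq] at h1
    calc μ * ‖q‖ ≤ ‖q‖⁻¹ * f q * ‖q‖ := by gcongr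
      _ = f q := by field_simp
  -- By `hle` the set `f = 1` lies in the closed ball of radius `μ⁻¹`, and it touches the boundary
  -- at `p`.
  set p := μ⁻¹ • e with hpdef
  have hp : p ≠ 0 := smul_ne_zero (inv_ne_zero hμ.ne') he0
  have hfp : f p = 1 := by rw [hpdef, hf.homog _ (inv_pos.2 hμ) e he0]; exact inv_mul_cancel₀ hμ.ne'
  have hpn : ‖p‖ = μ⁻¹ := by
    rw [hpdef, norm_smul, he1, mul_one, norm_inv, Real.norm_of_nonneg hμ.le]
  have near : ∀ v : V, ∀ᶠ t in 𝓝 (0 : ℝ), p + t • v ≠ 0 := by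
    intro v
    have : ContinuousAt (fun t : ℝ ↦ p + t • v) 0 := by fun_prop
    exact this.eventually_ne (by simpa using hp)
  -- The function `f² / 2 - μ² ‖·‖² / 2` is nonnegative off the origin and vanishes at `p`. Its
  -- first derivative gives `grad f = μ² p`, its second the lower bound `μ²` for the Hessian of `f²
  -- / 2`. Dividing by `‖grad f‖ = μ` bounds the principal curvatures below by `μ = ‖p‖⁻¹`.
  have hmin' : ∀ v : V, IsLocalMin
      (fun t : ℝ ↦ f (p + t • v) ^ 2 / 2 - μ ^ 2 * ‖p + t • v‖ ^ 2 / 2) 0 := by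
    intro v
    filter_upwards [near v] with t ht
    have h1 := hle _ ht
    have h2 : (μ * ‖p + t • v‖) ^ 2 ≤ f (p + t • v) ^ 2 := by gcongr
    have h3 : f (p + (0 : ℝ) • v) ^ 2 / 2 - μ ^ 2 * ‖p + (0 : ℝ) • v‖ ^ 2 / 2 = 0 := by
      rw [zero_smul, add_zero, hfp, hpn]
      field_simp
      ring
    rw [h3]
    linarith
  have hn : ∀ (v : V) (t : ℝ), HasDerivAt (fun t : ℝ ↦ μ ^ 2 * ‖p + t • v‖ ^ 2 / 2)
      (μ ^ 2 * inner ℝ (p + t • v) v) t := by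
    intro v t
    have h1 : HasDerivAt (fun t : ℝ ↦ p + t • v) v t := by
      simpa using ((hasDerivAt_id t).smul_const v).const_add p
    refine ((h1.norm_sq.const_mul (μ ^ 2)).div_const 2).congr_deriv ?_
    ring
  have hq1 : ∀ v : V, ∀ᶠ t in 𝓝 (0 : ℝ), HasDerivAt
      (fun t : ℝ ↦ f (p + t • v) ^ 2 / 2 - μ ^ 2 * ‖p + t • v‖ ^ 2 / 2)
      (inner ℝ (f (p + t • v) • gradient f (p + t • v)) v - μ ^ 2 * inner ℝ (p + t • v) v) t := by
    intro v
    filter_upwards [near v] with t ht using (hf.hasDerivAt_half_sq v ht).sub (hn v t)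
  have hq2 : ∀ v : V, HasDerivAt
      (fun t : ℝ ↦ inner ℝ (f (p + t • v) • gradient f (p + t • v)) v
        - μ ^ 2 * inner ℝ (p + t • v) v)
      (inner ℝ (fderiv ℝ (fun q ↦ f q • gradient f q) p v) v - μ ^ 2 * ‖v‖ ^ 2) 0 := by
    intro v
    have h1 : HasDerivAt (fun t : ℝ ↦ p + t • v) v 0 := by
      simpa using ((hasDerivAt_id (0 : ℝ)).smul_const v).const_add p
    have h2 := hf.hasDerivAt_inner_smul_gradient (p := p) v (t := 0) (by simpa using hp)
    rw [zero_smul, add_zero] at h2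
    refine h2.sub (((h1.inner ℝ (hasDerivAt_const 0 v)).const_mul (μ ^ 2)).congr_deriv ?_)
    simp
  have hB : ∀ v : V, μ ^ 2 * ‖v‖ ^ 2 ≤
      inner ℝ (fderiv ℝ (fun q ↦ f q • gradient f q) p v) v := by
    intro v
    have := second_deriv_nonneg_of_isLocalMin (hmin' v) (hq1 v) (hq2 v)
    linarith
  have hgrad : gradient f p = μ ^ 2 • p := by
    refine ext_inner_right ℝ fun v ↦ ?_
    have h1 := (hmin' v).hasDerivAt_eq_zero (hq1 v).self_of_nhds
    rw [zero_smul, add_zero, hfp, one_smul] at h1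
    rw [real_inner_smul_left]
    linarith
  have hgn : ‖gradient f p‖ = μ := by
    rw [hgrad, norm_smul, hpn, Real.norm_of_nonneg (by positivity)]
    field_simp
  refine ⟨p, hp, hfp, ?_, fun v hv ↦ lt_of_lt_of_le (by positivity) (hB v)⟩
  rw [hpn, inv_inv, ← hf.finrank_levelTangent hp]
  refine (hf.isSymmetric_shapeOperator hp).pow_le_det hμ.le fun t ↦ ?_
  have h1 := hB (t : V)
  rw [hf.fderiv_smul_gradient_apply hp, (mem_levelTangent_iff _).1 t.2, zero_smul, add_zero, hfp,
    one_smul] at h1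
  rw [hf.inner_shapeOperator hp, hgn]
  change μ * ‖(t : V)‖ ^ 2 ≤ _
  calc μ * ‖(t : V)‖ ^ 2 = μ⁻¹ * (μ ^ 2 * ‖(t : V)‖ ^ 2) := by field_simp
    _ ≤ _ := by gcongr

/-- If the Gaussian curvature of the level hypersurface does not vanish, then half the square of
the gauge is strictly convex. -/
theorem inner_fderiv_smul_gradient_pos [FiniteDimensional ℝ V] (hV : 1 < Module.rank ℝ V)
    (hf : IsSmoothGauge f) (hK : ∀ p ≠ 0, f p = 1 → gaussCurvature f p ≠ 0) {p : V} (hp : p ≠ 0)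
    {v : V} (hv : v ≠ 0) :
    0 < inner ℝ (fderiv ℝ (fun q ↦ f q • gradient f q) p v) v := by
  set B := fderiv ℝ fun q ↦ f q • gradient f q
  have hcont : ContinuousOn B {0}ᶜ := hf.continuousOn_fderiv_smul_gradient
  have hinj : ∀ q ≠ 0, ∀ w, B q w = 0 → w = 0 := by
    intro q hq w hw
    have hfq := hf.pos q hq
    -- The curvature hypothesis holds on `f = 1` only; `B` is homogeneous of degree zero, so `q` may
    -- be moved there.
    have hq' : (f q)⁻¹ • q ≠ 0 := smul_ne_zero (inv_ne_zero hfq.ne') hq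
    refine hf.eq_zero_of_fderiv_smul_gradient_eq_zero hq' (hK _ hq' ?_) ?_
    · rw [hf.homog _ (inv_pos.2 hfq) q hq, inv_mul_cancel₀ hfq.ne']
    · rwa [hf.fderiv_smul_gradient_smul (inv_pos.2 hfq) hq]
  have hpsd : ∀ q ≠ 0, (∀ w, 0 ≤ inner ℝ (B q w) w) → ∀ w ≠ 0, 0 < inner ℝ (B q w) w := by
    intro q hq h w hw
    refine (h w).lt_of_ne' fun h0 ↦ hw (hinj q hq w ?_)
    exact eq_zero_of_inner_self_eq_zero_of_nonneg (hf.inner_fderiv_smul_gradient_comm hq) h h0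
  have : Nontrivial V := nontrivial_of_ne p 0 hp
  obtain ⟨p₀, hp₀, -, -, hpos₀⟩ := hf.exists_inv_norm_pow_le_gaussCurvature
  have hconn := (isConnected_compl_singleton_of_one_lt_rank hV (0 : V)).isPreconnected
  -- Either `B q` is negative on some vector, or it is semidefinite and then definite by `hpsd`. So
  -- the disjoint sets `P` and `N` cover the connected complement of the origin; both are open and
  -- `p₀ ∈ P`, which leaves no room for `N`.
  set P : Set V := {q | q ∈ ({0}ᶜ : Set V) ∧ ∀ w ≠ 0, 0 < inner ℝ (B q w) w}
  set N : Set V := {q | q ∈ ({0}ᶜ : Set V) ∧ ∃ w, inner ℝ (B q w) w < 0}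
  have hN : IsOpen N := by
    have : N = ⋃ w : V, {q | q ∈ ({0}ᶜ : Set V) ∧ inner ℝ (B q w) w < 0} := by
      ext q
      simp only [N, Set.mem_iUnion, Set.mem_ofPred_eq]
      tauto
    rw [this]
    refine isOpen_iUnion fun w ↦ ?_
    have hc : ContinuousOn (fun q ↦ inner ℝ (B q w) w) {0}ᶜ :=
      (hcont.clm_apply continuousOn_const).inner continuousOn_const
    exact hc.isOpen_inter_preimage isOpen_compl_singleton isOpen_Iio
  have hP : IsOpen P := by
    rw [isOpen_iff_mem_nhds]
    rintro q ⟨hq, hpos⟩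
    have hc : ContinuousOn (fun z : V × V ↦ inner ℝ (B z.1 z.2) z.2) ({0}ᶜ ×ˢ Set.univ) :=
      ((hcont.comp continuousOn_fst fun z hz ↦ hz.1).clm_apply continuousOn_snd).inner
        continuousOn_snd
    -- Compactness of the unit sphere makes the neighbourhood of `q` independent of `w`.
    have h1 : ∀ᶠ q' in 𝓝 q, ∀ w ∈ Metric.sphere (0 : V) 1, 0 < inner ℝ (B q' w) w := by
      refine (isCompact_sphere (0 : V) 1).eventually_forall_of_forall_eventually fun w hw ↦ ?_
      have hw0 : w ≠ 0 := by
        rintro rfl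
        simp at hw
      have hc' : ContinuousAt (fun z : V × V ↦ inner ℝ (B z.1 z.2) z.2) (q, w) :=
        hc.continuousAt ((isOpen_compl_singleton.prod isOpen_univ).mem_nhds ⟨hq, trivial⟩)
      exact hc'.eventually (lt_mem_nhds (hpos w hw0))
    filter_upwards [h1, isOpen_compl_singleton.mem_nhds hq] with q' hq' hq'0
    refine ⟨hq'0, fun w hw ↦ ?_⟩
    have hwn : 0 < ‖w‖ := norm_pos_iff.mpr hw
    have h2 := hq' (‖w‖⁻¹ • w) (by simp [norm_smul, hwn.ne'])
    rw [map_smul, real_inner_smul_left, real_inner_smul_right, ← mul_assoc] at h2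
    exact pos_of_mul_pos_right h2 (by positivity)
  have hcover : ({0}ᶜ : Set V) ⊆ P ∪ N := by
    intro q hq
    by_cases h : ∀ w, 0 ≤ inner ℝ (B q w) w
    · exact Or.inl ⟨hq, hpsd q hq h⟩
    · push Not at h
      exact Or.inr ⟨hq, h⟩
  by_contra hcon
  have hpN : p ∈ N := by
    rcases hcover hp with h | h
    · exact absurd (h.2 v hv) hcon
    · exact h
  obtain ⟨q, -, ⟨hq, h1⟩, ⟨-, w, h2⟩⟩ := hconn P N hP hN hcover ⟨p₀, hp₀, hp₀, hpos₀⟩ ⟨p, hp, hpN⟩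
  by_cases hw : w = 0
  · simp [hw] at h2
  · exact (h1 w hw).asymm h2

end IsSmoothGauge

namespace IsSmoothGauge

open Topology Filter

variable {V : Type*} [NormedAddCommGroup V] [InnerProductSpace ℝ V]

theorem _root_.hasFDerivAt_norm_of_ne_zero {y : V} (hy : y ≠ 0) :
    HasFDerivAt (fun y : V ↦ ‖y‖) (‖y‖⁻¹ • innerSL ℝ y) y := by
  have hyn : 0 < ‖y‖ := norm_pos_iff.mpr hy
  have h1 : HasFDerivAt (fun y : V ↦ ‖y‖ ^ 2) (2 • innerSL ℝ y) y :=
    (hasStrictFDerivAt_norm_sq y).hasFDerivAt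
  have h2 := h1.sqrt (by positivity)
  simp only [Real.sqrt_sq (norm_nonneg _)] at h2
  refine h2.congr_fderiv ?_
  ext v
  simp
  field_simp

theorem const_mul_norm {c : ℝ} (hc : 0 < c) : IsSmoothGauge fun p : V ↦ c * ‖p‖ where
  contDiffOn := fun p hp ↦ (contDiffAt_const.mul (contDiffAt_norm ℝ hp)).contDiffWithinAt
  pos p hp := mul_pos hc (norm_pos_iff.mpr hp)
  homog a ha p _ := by rw [norm_smul, Real.norm_of_nonneg ha.le]; ring

variable [CompleteSpace V] {f : V → ℝ}

/-! #### Gauges whose level hypersurface is at least as curved as the spheres -/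

/-- If half the square of the gauge is strictly convex, then the degree one homogeneous extension
of the Gauss map, as a map of spheres, is injective. -/
theorem injOn_norm_smul_gaussMap (hf : IsSmoothGauge f)
    (hB : ∀ p ≠ 0, ∀ v ≠ 0, 0 < inner ℝ (fderiv ℝ (fun q ↦ f q • gradient f q) p v) v) :
    Set.InjOn (fun y ↦ ‖y‖ • gaussMap f y) {0}ᶜ := by
  intro y₁ hy₁ y₂ hy₂ h
  replace hy₁ : y₁ ≠ 0 := hy₁
  replace hy₂ : y₂ ≠ 0 := hy₂
  have hn : ‖y₁‖ = ‖y₂‖ := by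
    have := congrArg norm h
    simpa [norm_smul, hf.norm_gaussMap hy₁, hf.norm_gaussMap hy₂] using this
  have hν : gaussMap f y₁ = gaussMap f y₂ := by
    have h' : ‖y₁‖ • gaussMap f y₁ = ‖y₂‖ • gaussMap f y₂ := h
    rw [hn] at h'
    exact smul_right_injective V (norm_ne_zero_iff.mpr hy₂) h'
  have hf₁ := hf.pos y₁ hy₁
  have hf₂ := hf.pos y₂ hy₂
  set p₁ := (f y₁)⁻¹ • y₁ with hp₁def
  set p₂ := (f y₂)⁻¹ • y₂ with hp₂def
  have hp₁ : p₁ ≠ 0 := smul_ne_zero (inv_ne_zero hf₁.ne') hy₁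
  have hp₂ : p₂ ≠ 0 := smul_ne_zero (inv_ne_zero hf₂.ne') hy₂
  have hfp₁ : f p₁ = 1 := by rw [hp₁def, hf.homog _ (inv_pos.2 hf₁) _ hy₁, inv_mul_cancel₀ hf₁.ne']
  have hfp₂ : f p₂ = 1 := by rw [hp₂def, hf.homog _ (inv_pos.2 hf₂) _ hy₂, inv_mul_cancel₀ hf₂.ne']
  have hν₁₂ : gaussMap f p₁ = gaussMap f p₂ := by
    rw [hp₁def, hp₂def, hf.gaussMap_smul (inv_pos.2 hf₁) hy₁,
      hf.gaussMap_smul (inv_pos.2 hf₂) hy₂, hν]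
  set c₁ := ‖gradient f p₁‖
  set c₂ := ‖gradient f p₂‖
  have hc₁ : 0 < c₁ := hf.norm_gradient_pos hp₁
  have hc₂ : 0 < c₂ := hf.norm_gradient_pos hp₂
  have hi₁ : inner ℝ (gaussMap f p₁) p₁ = c₁⁻¹ := by
    rw [hf.inner_gaussMap_self hp₁, hfp₁, one_div]
  have hi₂ : inner ℝ (gaussMap f p₁) p₂ = c₂⁻¹ := by
    rw [hν₁₂, hf.inner_gaussMap_self hp₂, hfp₂, one_div]
  -- Two points of `f = 1` with the same normal: by strict convexity `⟨grad (f² / 2), p₂ - p₁⟩`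
  -- increases strictly along the segment, but its increment is `-(c₁ - c₂)² / (c₁ c₂) ≤ 0`.
  have heq : p₁ = p₂ := by
    by_contra hne
    have hδ : p₂ - p₁ ≠ 0 := sub_ne_zero.2 (Ne.symm hne)
    -- The segment must avoid the origin, where `f` need not be smooth: the common normal has
    -- positive inner product with both endpoints.
    have hseg : ∀ t ∈ Set.Icc (0 : ℝ) 1, p₁ + t • (p₂ - p₁) ≠ 0 := by
      intro t ht h0
      have h1 : inner ℝ (gaussMap f p₁) (p₁ + t • (p₂ - p₁)) = (1 - t) * c₁⁻¹ + t * c₂⁻¹ := by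
        rw [inner_add_right, real_inner_smul_right (gaussMap f p₁) (p₂ - p₁), inner_sub_right, hi₁,
          hi₂]
        ring
      rw [h0, inner_zero_right] at h1
      have hc₁' : 0 < c₁⁻¹ := inv_pos.2 hc₁
      have hc₂' : 0 < c₂⁻¹ := inv_pos.2 hc₂
      rcases ht.1.eq_or_lt with h2 | h2
      · rw [← h2] at h1
        linarith
      · have h3 : 0 < t * c₂⁻¹ := mul_pos h2 hc₂'
        have h4 : 0 ≤ (1 - t) * c₁⁻¹ := mul_nonneg (by linarith [ht.2]) hc₁'.le
        linarith
    have hmono : StrictMonoOn (fun t : ℝ ↦ inner ℝ (f (p₁ + t • (p₂ - p₁)) •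
        gradient f (p₁ + t • (p₂ - p₁))) (p₂ - p₁)) (Set.Icc 0 1) := by
      refine strictMonoOn_of_deriv_pos (convex_Icc 0 1)
        (fun t ht ↦ (hf.hasDerivAt_inner_smul_gradient _
          (hseg t ht)).continuousAt.continuousWithinAt) fun t ht ↦ ?_
      have ht' := hseg t (interior_subset ht)
      rw [(hf.hasDerivAt_inner_smul_gradient _ ht').deriv]
      exact hB _ ht' _ hδ
    have hlt := hmono (Set.left_mem_Icc.2 zero_le_one) (Set.right_mem_Icc.2 zero_le_one) zero_lt_one
    simp only [zero_smul, add_zero, one_smul, add_sub_cancel, hfp₁, hfp₂] at hlt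
    rw [hf.gradient_eq_smul_gaussMap hp₁, hf.gradient_eq_smul_gaussMap hp₂, ← hν₁₂,
      real_inner_smul_left, real_inner_smul_left, inner_sub_right, hi₁, hi₂] at hlt
    change c₁ * _ < c₂ * _ at hlt
    have h1 : c₁ * (c₂⁻¹ - c₁⁻¹) - c₂ * (c₂⁻¹ - c₁⁻¹) = (c₁ - c₂) ^ 2 / (c₁ * c₂) := by
      field_simp
    have h2 : 0 ≤ (c₁ - c₂) ^ 2 / (c₁ * c₂) := by positivity
    linarith
  have hnp : ‖p₁‖ = ‖p₂‖ := by rw [heq]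
  rw [hp₁def, hp₂def, norm_smul, norm_smul, hn] at hnp
  have hff : (f y₁)⁻¹ = (f y₂)⁻¹ := by
    have := mul_right_cancel₀ (norm_ne_zero_iff.mpr hy₂) hnp
    rwa [norm_inv, norm_inv, Real.norm_of_nonneg hf₁.le, Real.norm_of_nonneg hf₂.le] at this
  rw [hp₁def, hp₂def, hff] at heq
  exact smul_right_injective V (inv_ne_zero hf₂.ne') heq

theorem hasFDerivAt_norm_smul_gaussMap (hf : IsSmoothGauge f) {y : V} (hy : y ≠ 0) :
    HasFDerivAt (fun y ↦ ‖y‖ • gaussMap f y)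
      (‖y‖ • fderiv ℝ (gaussMap f) y + (‖y‖⁻¹ • innerSL ℝ y).smulRight (gaussMap f y)) y :=
  (hasFDerivAt_norm_of_ne_zero hy).smul (hf.differentiableAt_gaussMap hy).hasFDerivAt

theorem det_fderiv_norm_smul_gaussMap [FiniteDimensional ℝ V] (hf : IsSmoothGauge f) {y : V}
    (hy : y ≠ 0) :
    (fderiv ℝ (fun y ↦ ‖y‖ • gaussMap f y) y).det =
      ‖y‖ ^ Module.finrank ℝ V * (inner ℝ (gaussMap f y) y)⁻¹ * gaussCurvature f y := by
  rw [(hf.hasFDerivAt_norm_smul_gaussMap hy).fderiv]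
  exact det_radial_map (hf.gradient_ne_zero hy) rfl (fderiv ℝ (gaussMap f) y).toLinearMap
    (hf.inner_gradient_fderiv_gaussMap hy) hy (hf.fderiv_gaussMap_self hy)
    (hf.inner_gaussMap_self_pos hy).ne'

/-- Both sides are homogeneous of degree zero in `y`, so it suffices to compare them on `f = 1`. -/
theorem norm_div_inner_gaussMap_le_det [FiniteDimensional ℝ V] (hf : IsSmoothGauge f)
    (hK : ∀ p ≠ 0, f p = 1 → ‖p‖⁻¹ ^ (Module.finrank ℝ V - 1) ≤ gaussCurvature f p) {y : V}
    (hy : y ≠ 0) :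
    ‖y‖ / inner ℝ (gaussMap f y) y ≤ (fderiv ℝ (fun y ↦ ‖y‖ • gaussMap f y) y).det := by
  have hfy := inv_pos.2 (hf.pos y hy)
  have hp : (f y)⁻¹ • y ≠ 0 := smul_ne_zero hfy.ne' hy
  have hfp : f ((f y)⁻¹ • y) = 1 := by
    rw [hf.homog _ hfy _ hy, inv_mul_cancel₀ (hf.pos y hy).ne']
  have h1 : fderiv ℝ (fun y ↦ ‖y‖ • gaussMap f y) ((f y)⁻¹ • y) =
      fderiv ℝ (fun y ↦ ‖y‖ • gaussMap f y) y :=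
    fderiv_smul_of_homogeneous_one
      (fun q hq ↦ (hf.hasFDerivAt_norm_smul_gaussMap hq).differentiableAt)
      (fun c hc q hq ↦ by
        rw [hf.gaussMap_smul hc hq, norm_smul, Real.norm_of_nonneg hc.le, mul_smul]) hfy hy
  have h2 : ‖y‖ / inner ℝ (gaussMap f y) y =
      ‖(f y)⁻¹ • y‖ / inner ℝ (gaussMap f ((f y)⁻¹ • y)) ((f y)⁻¹ • y) := by
    rw [hf.gaussMap_smul hfy hy, norm_smul, Real.norm_of_nonneg hfy.le, real_inner_smul_right,
      mul_div_mul_left _ _ hfy.ne']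
  rw [← h1, h2]
  set p := (f y)⁻¹ • y
  have hpn : 0 < ‖p‖ := norm_pos_iff.mpr hp
  have ha := hf.inner_gaussMap_self_pos hp
  have : Nontrivial V := nontrivial_of_ne p 0 hp
  have hm : 0 < Module.finrank ℝ V := Module.finrank_pos
  obtain ⟨k, hk⟩ : ∃ k, Module.finrank ℝ V = k + 1 := ⟨_, (Nat.succ_pred_eq_of_pos hm).symm⟩
  rw [hf.det_fderiv_norm_smul_gaussMap hp]
  calc ‖p‖ / inner ℝ (gaussMap f p) p
      = ‖p‖ ^ Module.finrank ℝ V * (inner ℝ (gaussMap f p) p)⁻¹ *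
        ‖p‖⁻¹ ^ (Module.finrank ℝ V - 1) := by
        rw [hk, Nat.add_sub_cancel, pow_succ, inv_pow]
        field_simp
    _ ≤ _ := by
        gcongr
        exact hK p hp hfp

theorem inner_gaussMap_le_norm (hf : IsSmoothGauge f) {y : V} (hy : y ≠ 0) :
    inner ℝ (gaussMap f y) y ≤ ‖y‖ := by
  simpa [hf.norm_gaussMap hy] using real_inner_le_norm (gaussMap f y) y

-- The punctured unit ball is mapped injectively into itself with Jacobian at least `‖y‖ / ⟨ν, y⟩ ≥
-- 1`. The change of variables formula forces this quotient to be `1` almost everywhere, hence by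
-- continuity everywhere on the ball; homogeneity carries this to all `y`.
open MeasureTheory in
theorem inner_gaussMap_eq_norm [FiniteDimensional ℝ V] (hV : 1 < Module.rank ℝ V)
    (hf : IsSmoothGauge f)
    (hK : ∀ p ≠ 0, f p = 1 → ‖p‖⁻¹ ^ (Module.finrank ℝ V - 1) ≤ gaussCurvature f p) {y : V}
    (hy : y ≠ 0) : inner ℝ (gaussMap f y) y = ‖y‖ := by
  borelize V
  have hK' : ∀ p ≠ 0, f p = 1 → gaussCurvature f p ≠ 0 := fun p hp hfp ↦ by
    have := norm_pos_iff.mpr hp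
    exact (lt_of_lt_of_le (by positivity) (hK p hp hfp)).ne'
  have hinj := hf.injOn_norm_smul_gaussMap
    fun p hp v hv ↦ hf.inner_fderiv_smul_gradient_pos hV hK' hp hv
  set s : Set V := Metric.ball 0 1 ∩ {0}ᶜ
  have hs : IsOpen s := Metric.isOpen_ball.inter isOpen_compl_singleton
  set μ : Measure V := Measure.addHaar
  have hcont : ContinuousOn (fun y ↦ ‖y‖ / inner ℝ (gaussMap f y) y) s := by
    intro q hq
    have h1 := (hf.contDiffAt_gaussMap hq.2).continuousAt
    exact (continuousAt_id.norm.div (h1.inner continuousAt_id)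
      (hf.inner_gaussMap_self_pos hq.2).ne').continuousWithinAt
  have hone : ∀ q ∈ s, 1 ≤ ‖q‖ / inner ℝ (gaussMap f q) q := fun q hq ↦ by
    rw [one_le_div (hf.inner_gaussMap_self_pos hq.2)]
    exact hf.inner_gaussMap_le_norm hq.2
  have hvol := lintegral_abs_det_fderiv_eq_addHaar_image μ hs.measurableSet
    (f := fun y ↦ ‖y‖ • gaussMap f y) (f' := fderiv ℝ fun y ↦ ‖y‖ • gaussMap f y)
    (fun q hq ↦
      (hf.hasFDerivAt_norm_smul_gaussMap hq.2).differentiableAt.hasFDerivAt.hasFDerivWithinAt)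
    (hinj.mono fun q hq ↦ hq.2)
  have himg : (fun y ↦ ‖y‖ • gaussMap f y) '' s ⊆ s := by
    rintro _ ⟨q, hq, rfl⟩
    have hq0 : q ≠ 0 := hq.2
    have hn : ‖‖q‖ • gaussMap f q‖ = ‖q‖ := by
      rw [norm_smul, norm_norm, hf.norm_gaussMap hq0, mul_one]
    refine ⟨by simpa [hn] using hq.1, ?_⟩
    rw [Set.mem_compl_singleton_iff, ← norm_ne_zero_iff, hn]
    exact norm_ne_zero_iff.mpr hq0
  have hle : ∫⁻ q in s, ENNReal.ofReal (‖q‖ / inner ℝ (gaussMap f q) q) ∂μ ≤ ∫⁻ _ in s, 1 ∂μ := by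
    calc ∫⁻ q in s, ENNReal.ofReal (‖q‖ / inner ℝ (gaussMap f q) q) ∂μ
        ≤ ∫⁻ q in s, ENNReal.ofReal |(fderiv ℝ (fun y ↦ ‖y‖ • gaussMap f y) q).det| ∂μ := by
          refine setLIntegral_mono' hs.measurableSet fun q hq ↦ ENNReal.ofReal_le_ofReal ?_
          exact (hf.norm_div_inner_gaussMap_le_det hK hq.2).trans (le_abs_self _)
      _ = μ ((fun y ↦ ‖y‖ • gaussMap f y) '' s) := hvol
      _ ≤ μ s := measure_mono himg
      _ = ∫⁻ _ in s, 1 ∂μ := by simp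
  have hfin : ∫⁻ _ in s, (1 : ENNReal) ∂μ ≠ ⊤ := by
    simp only [lintegral_const, MeasurableSet.univ, Measure.restrict_apply, Set.univ_inter, one_mul]
    exact ((measure_mono Set.inter_subset_left).trans_lt measure_ball_lt_top).ne
  have hae := ae_eq_of_ae_le_of_lintegral_le
    (f := fun _ : V ↦ (1 : ENNReal)) (μ := μ.restrict s)
    (g := fun q ↦ ENNReal.ofReal (‖q‖ / inner ℝ (gaussMap f q) q))
    ((ae_restrict_iff' hs.measurableSet).2 (ae_of_all _ fun q hq ↦ by
      simpa using hone q hq)) hfin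
    (hcont.aemeasurable hs.measurableSet).ennreal_ofReal hle
  have hae' : (fun y ↦ ‖y‖ / inner ℝ (gaussMap f y) y) =ᵐ[μ.restrict s] fun _ ↦ (1 : ℝ) := by
    filter_upwards [hae] with q hq
    exact ENNReal.ofReal_eq_one.1 hq.symm
  have heq := Measure.eqOn_open_of_ae_eq hae' hs hcont continuousOn_const
  have hyn : 0 < ‖y‖ := norm_pos_iff.mpr hy
  set c := (2 * ‖y‖)⁻¹
  have hc : 0 < c := by positivity
  have hcy : c • y ∈ s := by
    refine ⟨?_, smul_ne_zero hc.ne' hy⟩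
    rw [mem_ball_zero_iff, norm_smul, Real.norm_of_nonneg hc.le]
    simp only [c]
    field_simp
    norm_num
  have h1 : ‖c • y‖ / inner ℝ (gaussMap f (c • y)) (c • y) = 1 := heq hcy
  rw [hf.gaussMap_smul hc hy, norm_smul, Real.norm_of_nonneg hc.le, real_inner_smul_right,
    mul_div_mul_left _ _ hc.ne', div_eq_one_iff_eq (hf.inner_gaussMap_self_pos hy).ne'] at h1
  exact h1.symm

/-- A radial hypersurface at least as curved at each point as the sphere about the origin through
this point is a sphere about the origin. -/
theorem eq_const_mul_norm [FiniteDimensional ℝ V] (hV : 1 < Module.rank ℝ V)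
    (hf : IsSmoothGauge f)
    (hK : ∀ p ≠ 0, f p = 1 → ‖p‖⁻¹ ^ (Module.finrank ℝ V - 1) ≤ gaussCurvature f p) :
    ∃ c > 0, ∀ p ≠ 0, f p = c * ‖p‖ := by
  -- Equality in the Cauchy–Schwarz inequality makes the Gauss map `y / ‖y‖`, so `f` has no
  -- derivative along the spheres and `f / ‖·‖` is locally constant.
  have hder : ∀ y ≠ 0, HasFDerivAt (fun q ↦ f q * ‖q‖⁻¹) (0 : V →L[ℝ] ℝ) y := by
    intro y hy
    have hyn : 0 < ‖y‖ := norm_pos_iff.mpr hy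
    have h1 := hf.inner_gaussMap_eq_norm hV hK hy
    have h2 : gaussMap f y = ‖y‖⁻¹ • y := by
      have h3 : inner ℝ (gaussMap f y) y = ‖gaussMap f y‖ * ‖y‖ := by
        rw [h1, hf.norm_gaussMap hy, one_mul]
      rw [inner_eq_norm_mul_iff_real, hf.norm_gaussMap hy, one_smul] at h3
      rw [eq_inv_smul_iff₀ hyn.ne', h3]
    have h4 : ‖gradient f y‖ = f y * ‖y‖⁻¹ := by
      have := hf.inner_gaussMap_self hy
      rw [h1, eq_div_iff (hf.norm_gradient_pos hy).ne'] at this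
      rw [← this]
      field_simp
    have h5 := (hf.differentiableAt hy).hasFDerivAt.mul
      ((hasDerivAt_inv hyn.ne').comp_hasFDerivAt y (hasFDerivAt_norm_of_ne_zero hy))
    refine h5.congr_fderiv ?_
    ext v
    have h6 : fderiv ℝ f y v = f y * ‖y‖⁻¹ * ‖y‖⁻¹ * inner ℝ y v := by
      rw [← inner_gradient_left, hf.gradient_eq_smul_gaussMap hy, h2, h4, smul_smul,
        real_inner_smul_left]
    simp [h6]
    field_simp
    ring
  have : Nontrivial V := by
    rw [← rank_pos_iff_nontrivial (R := ℝ)]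
    exact zero_lt_one.trans hV
  obtain ⟨p₀, hp₀⟩ := exists_ne (0 : V)
  have hp₀n : 0 < ‖p₀‖ := norm_pos_iff.mpr hp₀
  refine ⟨f p₀ * ‖p₀‖⁻¹, mul_pos (hf.pos _ hp₀) (inv_pos.2 hp₀n), fun p hp ↦ ?_⟩
  have hpn : 0 < ‖p‖ := norm_pos_iff.mpr hp
  have h := IsOpen.is_const_of_fderiv_eq_zero (𝕜 := ℝ) (f := fun q : V ↦ f q * ‖q‖⁻¹)
    isOpen_compl_singleton (isConnected_compl_singleton_of_one_lt_rank hV (0 : V)).isPreconnected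
    (fun q hq ↦ (hder q hq).differentiableAt.differentiableWithinAt)
    (fun q hq ↦ (hder q hq).fderiv) hp₀ hp
  rw [h]
  field_simp

/-! #### Spheres -/

theorem _root_.gaussCurvature_const_mul_norm [FiniteDimensional ℝ V] {c : ℝ} (hc : 0 < c) {p : V}
    (hp : p ≠ 0) :
    gaussCurvature (fun p : V ↦ c * ‖p‖) p = ‖p‖⁻¹ ^ (Module.finrank ℝ V - 1) := by
  have hf := const_mul_norm (V := V) hc
  set f := fun p : V ↦ c * ‖p‖
  have hgrad : ∀ q ≠ 0, gradient f q = (c * ‖q‖⁻¹) • q := by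
    intro q hq
    refine ext_inner_right ℝ fun v ↦ ?_
    rw [inner_gradient_left, ((hasFDerivAt_norm_of_ne_zero hq).const_mul c).fderiv]
    simp [real_inner_smul_left, mul_assoc]
  have hgauss : ∀ q ≠ 0, gaussMap f q = ‖q‖⁻¹ • q := by
    intro q hq
    have hqn : 0 < ‖q‖ := norm_pos_iff.mpr hq
    rw [gaussMap, hgrad q hq, norm_smul, smul_smul, Real.norm_of_nonneg (by positivity)]
    congr 1
    field_simp
  have hder : HasFDerivAt (gaussMap f) _ p :=
    (((hasDerivAt_inv (norm_ne_zero_iff.mpr hp)).comp_hasFDerivAt p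
      (hasFDerivAt_norm_of_ne_zero hp)).smul (hasFDerivAt_id p)).congr_of_eventuallyEq (by
      filter_upwards [isOpen_compl_singleton.mem_nhds hp] with q hq using hgauss q hq)
  have hS : shapeOperator f p = ‖p‖⁻¹ • LinearMap.id := by
    ext t
    have ht : inner ℝ p (t : V) = 0 := by
      have := (mem_levelTangent_iff _).1 t.2
      rw [hgrad p hp, real_inner_smul_left] at this
      have hpn : 0 < ‖p‖ := norm_pos_iff.mpr hp
      exact (mul_eq_zero.1 this).resolve_left (by positivity)
    rw [hf.coe_shapeOperator hp, hder.fderiv]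
    simp [ht]
  rw [gaussCurvature, hS, LinearMap.det_smul, LinearMap.det_id, mul_one, hf.finrank_levelTangent hp]

end IsSmoothGauge

/-! ### The Hessian for the Levi-Civita connection -/

section Hessian

open Topology Filter VectorField

variable {EM : Type*} [NormedAddCommGroup EM] [NormedSpace ℝ EM]
  {H : Type*} [TopologicalSpace H] {I : ModelWithCorners ℝ EM H}
  {M : Type*} [TopologicalSpace M] [ChartedSpace H M]

theorem MDifferentiableAt.mvfderiv_apply [IsManifold I ∞ M] {h : M → ℝ} {x : M}
    (hh : CMDiffAt ∞ h x) {Y : Π x : M, TangentSpace I x} (hY : MDiffAt (T% Y) x) :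
    MDiffAt (fun y ↦ mvfderiv I h y (Y y)) x := by
  have h1 := hh.mfderiv_const (m := 1) (by rw [one_add_one_eq_two]; exact ENat.LEInfty.out)
  have h2 := MDifferentiableAt.clm_apply_of_inCoordinates (b₁ := id) (b₂ := h) (v := Y)
    (ϕ := fun y ↦ mfderiv I 𝓘(ℝ, ℝ) h y) (h1.mdifferentiableAt (by simp)) hY
    (hh.mdifferentiableAt (by simp))
  exact ((contMDiff_snd_tangentBundle_modelSpace ℝ 𝓘(ℝ, ℝ) (n := 1)).contMDiffAt.mdifferentiableAt
    (by simp)).comp x h2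

variable [IsManifold I ∞ M] [RiemannianBundle (fun x : M ↦ TangentSpace I x)]

variable (I) in
/-- The second covariant derivative of a function for the Levi-Civita connection. -/
def hessian [FiniteDimensional ℝ EM] (h : M → ℝ) (X Y : Π x : M, TangentSpace I x) (x : M) : ℝ :=
  mvfderiv I (fun y ↦ mvfderiv I h y (Y y)) x (X x) - mvfderiv I h x (leviCivita I X Y x)

variable [IsContMDiffRiemannianBundle I ∞ EM (fun x : M ↦ TangentSpace I x)]
  {X Y Z : Π x : M, TangentSpace I x} {x : M}

theorem MDifferentiableAt.inner_tangent (hX : MDiffAt (T% X) x) (hY : MDiffAt (T% Y) x) :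
    MDiffAt (fun y ↦ inner ℝ (X y) (Y y)) x :=
  MDifferentiableAt.inner_bundle (E := fun x : M ↦ TangentSpace I x) hX hY

variable [FiniteDimensional ℝ EM]

/-- The derivatives of the factor `f` coming from the first two terms cancel against those from the
brackets `[X, fZ]` and `[Y, fZ]`. Tensoriality frees `leviCivita` from the particular extension of
the basis used to define it. -/
theorem koszul_tensorialAt_right (hX : MDiffAt (T% X) x) (hY : MDiffAt (T% Y) x) :
    TensorialAt I EM (fun Z : Π x : M, TangentSpace I x ↦ koszul I X Y Z x) x where
  smul {f Z} hf hZ := by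
    have h1 : mvfderiv I (fun y ↦ inner ℝ (Y y) ((f • Z) y)) x (X x) =
        f x * mvfderiv I (fun y ↦ inner ℝ (Y y) (Z y)) x (X x)
          + inner ℝ (Y x) (Z x) * mvfderiv I f x (X x) := by
      have : (fun y ↦ inner ℝ (Y y) ((f • Z) y)) = fun y ↦ f y * inner ℝ (Y y) (Z y) := by
        ext y
        simp [real_inner_smul_right]
      rw [this, mvfderiv_fun_mul hf (hY.inner_tangent hZ)]
      simp
    have h2 : mvfderiv I (fun y ↦ inner ℝ ((f • Z) y) (X y)) x (Y x) =
        f x * mvfderiv I (fun y ↦ inner ℝ (Z y) (X y)) x (Y x)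
          + inner ℝ (Z x) (X x) * mvfderiv I f x (Y x) := by
      have : (fun y ↦ inner ℝ ((f • Z) y) (X y)) = fun y ↦ f y * inner ℝ (Z y) (X y) := by
        ext y
        simp [real_inner_smul_left]
      rw [this, mvfderiv_fun_mul hf (hZ.inner_tangent hX)]
      simp
    simp only [koszul]
    rw [h1, h2]
    simp only [mlieBracket_smul_right hf hZ, Pi.smul_apply', map_smul,
      inner_add_left, real_inner_smul_left, real_inner_smul_right, smul_eq_mul,
      real_inner_comm (Z x) (Y x)]
    ring
  add {Z Z'} hZ hZ' := by
    have h1 : (fun y ↦ inner ℝ (Y y) ((Z + Z') y)) =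
        fun y ↦ inner ℝ (Y y) (Z y) + inner ℝ (Y y) (Z' y) := by
      ext y
      simp [inner_add_right]
    have h2 : (fun y ↦ inner ℝ ((Z + Z') y) (X y)) =
        fun y ↦ inner ℝ (Z y) (X y) + inner ℝ (Z' y) (X y) := by
      ext y
      simp [inner_add_left]
    simp only [koszul]
    rw [h1, h2]
    simp only [mlieBracket_add_right hZ hZ', Pi.add_apply, map_add,
      mvfderiv_fun_add (hY.inner_tangent hZ) (hY.inner_tangent hZ'),
      mvfderiv_fun_add (hZ.inner_tangent hX) (hZ'.inner_tangent hX),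
      inner_add_left, inner_add_right, _root_.add_apply]
    ring

theorem two_mul_inner_leviCivita (hX : MDiffAt (T% X) x) (hY : MDiffAt (T% Y) x)
    (hZ : MDiffAt (T% Z) x) : 2 * inner ℝ (leviCivita I X Y x) (Z x) = koszul I X Y Z x := by
  have : FiniteDimensional ℝ (TangentSpace I x) := inferInstanceAs (FiniteDimensional ℝ EM)
  have hT := koszul_tensorialAt_right hX hY
  have h1 := TensorialAt.mkHom_apply hT hZ
  set b := stdOrthonormalBasis ℝ (TangentSpace I x)
  have h2 : leviCivita I X Y x = ∑ i, (koszul I X Y (FiberBundle.extend EM (b i)) x / 2) • b i :=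
    rfl
  rw [← h1, h2, sum_inner, Finset.mul_sum]
  conv_rhs => rw [← b.sum_repr' (Z x), map_sum]
  refine Finset.sum_congr rfl fun i _ ↦ ?_
  rw [map_smul, TensorialAt.mkHom_apply_eq_extend, real_inner_smul_left, smul_eq_mul]
  ring

end Hessian

/-! ### Convex functions on closed Riemannian manifolds -/

section FirstDerivative

open Topology Filter

variable {EM : Type*} [NormedAddCommGroup EM] [NormedSpace ℝ EM]
  {H : Type*} [TopologicalSpace H] {I : ModelWithCorners ℝ EM H} [I.Boundaryless]
  {M : Type*} [TopologicalSpace M] [ChartedSpace H M] {ρ : M → ℝ}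

/-- No differentiability is assumed: where it fails the derivative is `0` by convention. Otherwise
the Euclidean criterion applies in a chart, whose model has full range as there is no boundary. -/
theorem IsLocalMax.mvfderiv_eq_zero {x : M} (h : IsLocalMax ρ x) : mvfderiv I ρ x = 0 := by
  by_cases hd : MDiffAt ρ x
  · have h1 : HasFDerivAt (writtenInExtChartAt I 𝓘(ℝ, ℝ) x ρ) (mfderiv I 𝓘(ℝ, ℝ) ρ x)
        (extChartAt I x x) := by
      have := hd.hasMFDerivAt.2
      rw [I.range_eq_univ] at this
      exact hasFDerivWithinAt_univ.1 this
    have h2 : Tendsto (extChartAt I x).symm (𝓝 (extChartAt I x x)) (𝓝 x) := by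
      simpa [ContinuousAt] using continuousAt_extChartAt_symm (I := I) x
    have h3 : IsLocalMax (writtenInExtChartAt I 𝓘(ℝ, ℝ) x ρ) (extChartAt I x x) := by
      filter_upwards [h2.eventually h] with y hy
      change ρ ((extChartAt I x).symm y) ≤ ρ ((extChartAt I x).symm (extChartAt I x x))
      rwa [extChartAt_to_inv]
    exact h3.hasFDerivAt_eq_zero h1
  · rw [mvfderiv, mfderiv_zero_of_not_mdifferentiableAt hd]
    rfl

theorem eq_of_mvfderiv_eq_zero [IsManifold I ∞ M] [PreconnectedSpace M] (hρ : CMDiff ∞ ρ)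
    (h : ∀ x, mvfderiv I ρ x = 0) (x y : M) : ρ x = ρ y := by
  have hloc : IsLocallyConstant ρ := by
    rw [IsLocallyConstant.iff_eventually_eq]
    intro x
    have hopen : IsOpen (extChartAt I x).target := isOpen_extChartAt_target x
    obtain ⟨r, hr, hball⟩ := Metric.isOpen_iff.1 hopen _ (mem_extChartAt_target x)
    have hd : ∀ z ∈ Metric.ball (extChartAt I x x) r,
        HasFDerivAt (ρ ∘ (extChartAt I x).symm) (0 : EM →L[ℝ] ℝ) z := by
      intro z hz
      have h1 : MDifferentiableAt 𝓘(ℝ, EM) I (extChartAt I x).symm z :=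
        ((contMDiffOn_extChartAt_symm (n := ∞) x).contMDiffAt
          (hopen.mem_nhds (hball hz))).mdifferentiableAt (by simp)
      have h2 : MDiffAt ρ ((extChartAt I x).symm z) := (hρ _).mdifferentiableAt (by simp)
      have h3 := h2.hasMFDerivAt.comp z h1.hasMFDerivAt
      have h4 : mfderiv I 𝓘(ℝ, ℝ) ρ ((extChartAt I x).symm z) = 0 := h _
      rw [h4, ContinuousLinearMap.zero_comp] at h3
      exact h3.hasFDerivAt
    have hc := (continuousAt_extChartAt (I := I) x).eventually_mem (Metric.ball_mem_nhds _ hr)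
    filter_upwards [hc, extChartAt_source_mem_nhds (I := I) x] with y hy hys
    have h5 := (convex_ball (extChartAt I x x) r).is_const_of_fderivWithin_eq_zero (𝕜 := ℝ)
      (f := ρ ∘ (extChartAt I x).symm)
      (fun z hz ↦ (hd z hz).differentiableAt.differentiableWithinAt)
      (fun z hz ↦ by
        rw [fderivWithin_of_isOpen Metric.isOpen_ball hz, (hd z hz).fderiv])
      hy (Metric.mem_ball_self hr)
    rwa [Function.comp_apply, (extChartAt I x).left_inv hys, Function.comp_apply,
      extChartAt_to_inv] at h5
  exact hloc.apply_eq_of_preconnectedSpace x y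

end FirstDerivative

section MaximumPrinciple

open Topology Filter

variable {EM : Type*} [NormedAddCommGroup EM] [NormedSpace ℝ EM]
  {H : Type*} [TopologicalSpace H] {I : ModelWithCorners ℝ EM H}
  {M : Type*} [TopologicalSpace M] [ChartedSpace H M] {ρ : M → ℝ}

theorem continuousAt_mvfderiv_comp_symmL [IsManifold I ∞ M] {x : M} (hρ : CMDiffAt ∞ ρ x) :
    ContinuousAt (fun y ↦ (mvfderiv I ρ y).comp
      ((trivializationAt EM (TangentSpace I) x).symmL ℝ y)) x := by
  have h1 := (hρ.mfderiv_const (m := ∞) (by simp)).continuousAt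
  convert h1 using 2 with y
  ext w
  simp [inTangentCoordinates, ContinuousLinearMap.inCoordinates]
  rfl

variable [RiemannianBundle (fun x : M ↦ TangentSpace I x)]

theorem isContinuousRiemannianBundle_tangentSpace [IsManifold I ∞ M]
    [IsContMDiffRiemannianBundle I ∞ EM (fun x : M ↦ TangentSpace I x)] :
    IsContinuousRiemannianBundle EM (fun x : M ↦ TangentSpace I x) := by
  obtain ⟨g, hg, h⟩ := IsContMDiffRiemannianBundle.exists_contMDiff (IB := I) (n := ∞) (F := EM)
    (E := fun x : M ↦ TangentSpace I x)
  exact ⟨g, hg.continuous, h⟩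

variable [FiniteDimensional ℝ EM]

variable (I) in
/-- The gradient of a function on a Riemannian manifold. -/
def riemannianGradient (ρ : M → ℝ) (x : M) : TangentSpace I x :=
  haveI : FiniteDimensional ℝ (TangentSpace I x) := inferInstanceAs (FiniteDimensional ℝ EM)
  haveI : CompleteSpace (TangentSpace I x) := FiniteDimensional.complete ℝ _
  (InnerProductSpace.toDual ℝ (TangentSpace I x)).symm (mvfderiv I ρ x)

theorem inner_riemannianGradient (ρ : M → ℝ) (x : M) (w : TangentSpace I x) :
    inner ℝ (riemannianGradient I ρ x) w = mvfderiv I ρ x w :=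
  haveI : FiniteDimensional ℝ (TangentSpace I x) := inferInstanceAs (FiniteDimensional ℝ EM)
  haveI : CompleteSpace (TangentSpace I x) := FiniteDimensional.complete ℝ _
  InnerProductSpace.toDual_symm_apply

theorem norm_riemannianGradient_le {x : M} {B : ℝ}
    (h : ∀ w : TangentSpace I x, mvfderiv I ρ x w ≤ B * ‖w‖) (hB : 0 ≤ B) :
    ‖riemannianGradient I ρ x‖ ≤ B := by
  have h1 := h (riemannianGradient I ρ x)
  rw [← inner_riemannianGradient, real_inner_self_eq_norm_sq] at h1
  by_contra! h2
  nlinarith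

variable [IsManifold I ∞ M]
  [IsContMDiffRiemannianBundle I ∞ EM (fun x : M ↦ TangentSpace I x)]

/-- Upper semicontinuity is all that is needed to attain a maximum. In the trivialisation at `x` the
differential of `ρ` varies continuously, and transporting a vector from `y` to `x` stretches it by
less than any prescribed `r > 1` for `y` near `x`. -/
theorem upperSemicontinuous_norm_riemannianGradient (hρ : CMDiff ∞ ρ) :
    UpperSemicontinuous fun x ↦ ‖riemannianGradient I ρ x‖ := by
  intro x c hc
  have := isContinuousRiemannianBundle_tangentSpace (I := I) (M := M)
  obtain ⟨C, hC, hCy⟩ := eventually_norm_trivializationAt_lt EM (fun x : M ↦ TangentSpace I x) x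
  have hA := continuousAt_mvfderiv_comp_symmL (I := I) (hρ x)
  set A := fun y ↦ (mvfderiv I ρ y).comp ((trivializationAt EM (TangentSpace I) x).symmL ℝ y)
  set a := ‖riemannianGradient I ρ x‖
  have ha : 0 ≤ a := norm_nonneg _
  have hc : a < c := hc
  obtain ⟨r, hr, hrc⟩ : ∃ r : ℝ, 1 < r ∧ a * r < c := by
    refine ((((continuous_const_mul a).tendsto' 1 a (by simp)).eventually_lt_const hc).filter_mono
      nhdsWithin_le_nhds |>.and (self_mem_nhdsWithin (s := Set.Ioi (1 : ℝ)))).exists.imp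
      fun r h ↦ ⟨h.2, h.1⟩
  have hsmall : ∀ᶠ y in 𝓝 x, ‖A y - A x‖ * C + a * r < c := by
    have : ContinuousAt (fun y ↦ ‖A y - A x‖ * C + a * r) x := by fun_prop
    refine this.eventually_lt_const ?_
    simpa using hrc
  filter_upwards [hsmall, hCy, eventually_norm_symmL_trivializationAt_self_comp_lt EM
    (fun x : M ↦ TangentSpace I x) x hr,
    (trivializationAt EM (TangentSpace I) x).open_baseSet.mem_nhds
      (FiberBundle.mem_baseSet_trivializationAt' x)] with y h1 h2 h3 hy
  refine lt_of_le_of_lt (norm_riemannianGradient_le (fun w ↦ ?_) (by positivity)) h1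
  have key : mvfderiv I ρ y w =
      (A y - A x) ((trivializationAt EM (TangentSpace I) x).continuousLinearMapAt ℝ y w) +
      mvfderiv I ρ x (((trivializationAt EM (TangentSpace I) x).symmL ℝ x ∘L
        (trivializationAt EM (TangentSpace I) x).continuousLinearMapAt ℝ y) w) := by
    simp only [A, sub_apply, ContinuousLinearMap.comp_apply]
    rw [Trivialization.symmL_continuousLinearMapAt _ hy]
    ring
  rw [key, add_mul, mul_assoc, mul_assoc, ← inner_riemannianGradient]
  refine add_le_add ?_ ?_
  · refine (Real.le_norm_self _).trans ((ContinuousLinearMap.le_opNorm _ _).trans ?_)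
    gcongr
    exact (ContinuousLinearMap.le_opNorm _ w).trans (by gcongr)
  · refine (real_inner_le_norm _ _).trans ?_
    gcongr
    exact (ContinuousLinearMap.le_opNorm _ w).trans (by gcongr)

/-- In the Koszul formula with three equal fields the bracket terms vanish and two of the
derivatives cancel. This is the only instance of metric compatibility needed for the maximum
principle. -/
theorem inner_leviCivita_self {X : Π x : M, TangentSpace I x} {x : M} (hX : MDiffAt (T% X) x) :
    2 * inner ℝ (leviCivita I X X x) (X x) = mvfderiv I (fun y ↦ inner ℝ (X y) (X y)) x (X x) := by
  rw [two_mul_inner_leviCivita hX hX hX, koszul]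
  simp

/-- If `|grad ρ| + ερ` had a maximum at a point where `v = grad ρ` does not vanish, then with `X` a
field extending `v` the function `Xρ - (c - ερ)|X|` would have the maximum `0` there, and its
derivative in the direction of `v` is `Hess ρ (v, v) + ε|v|³ > 0`. -/
theorem riemannianGradient_eq_zero_of_isMaxOn [I.Boundaryless] (hρ : CMDiff ∞ ρ) {q : M}
    (hess : ∀ v : TangentSpace I q,
      0 ≤ hessian I ρ (FiberBundle.extend EM v) (FiberBundle.extend EM v) q)
    {ε : ℝ} (hε : 0 < ε) (hq : ∀ y, ‖riemannianGradient I ρ y‖ + ε * ρ y ≤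
      ‖riemannianGradient I ρ q‖ + ε * ρ q) : riemannianGradient I ρ q = 0 := by
  by_contra hv0
  set v := riemannianGradient I ρ q with hv
  have hvn : 0 < ‖v‖ := norm_pos_iff.mpr hv0
  have hvw (w : TangentSpace I q) : mvfderiv I ρ q w = inner ℝ v w :=
    (inner_riemannianGradient ρ q w).symm
  set X : Π x : M, TangentSpace I x := FiberBundle.extend EM v with hXdef
  have hXq : X q = v := FiberBundle.extend_apply_self ..
  have hX : MDiffAt (T% X) q := FiberBundle.mdifferentiableAt_extend ..
  have hXX := hX.inner_tangent hX
  have hpos : 0 < inner ℝ (X q) (X q) := by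
    rw [hXq, real_inner_self_eq_norm_sq]
    positivity
  set c := ‖v‖ + ε * ρ q with hc
  set R : M → ℝ := fun y ↦ mvfderiv I ρ y (X y) - (c - ε * ρ y) * √(inner ℝ (X y) (X y)) with hR
  have hRle (y : M) : R y ≤ 0 := by
    have h1 : mvfderiv I ρ y (X y) ≤ ‖riemannianGradient I ρ y‖ * ‖X y‖ := by
      rw [← inner_riemannianGradient]
      exact real_inner_le_norm _ _
    have h2 : ‖riemannianGradient I ρ y‖ ≤ c - ε * ρ y := by linarith [hq y]
    have h3 : √(inner ℝ (X y) (X y)) = ‖X y‖ := (norm_eq_sqrt_real_inner _).symm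
    simp only [hR, h3]
    nlinarith [norm_nonneg (X y)]
  have hsq : √(inner ℝ (X q) (X q)) = ‖v‖ := by
    rw [hXq]
    exact (norm_eq_sqrt_real_inner _).symm
  have hRq : R q = 0 := by
    simp only [hR, hsq]
    rw [hXq, hvw, real_inner_self_eq_norm_sq, hc]
    ring
  have hsqrt : MDiffAt (fun y ↦ √(inner ℝ (X y) (X y))) q :=
    (Real.hasDerivAt_sqrt hpos.ne').differentiableAt.mdifferentiableAt.comp q hXX
  have hρq : MDiffAt ρ q := (hρ q).mdifferentiableAt (by simp)
  have hmax : mvfderiv I R q = 0 := by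
    refine IsLocalMax.mvfderiv_eq_zero (Eventually.of_forall fun y ↦ ?_)
    rw [hRq]
    exact hRle y
  have hder : mvfderiv I (fun y ↦ √(inner ℝ (X y) (X y))) q v * ‖v‖ =
      inner ℝ v (leviCivita I X X q) := by
    have h1 : mvfderiv I (fun y ↦ √(inner ℝ (X y) (X y)) * √(inner ℝ (X y) (X y))) q v =
        mvfderiv I (fun y ↦ inner ℝ (X y) (X y)) q (X q) := by
      rw [hXq]
      congr 2
      ext y
      exact Real.mul_self_sqrt real_inner_self_nonneg
    rw [mvfderiv_fun_mul hsqrt hsqrt, ← inner_leviCivita_self hX, hsq, hXq,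
      real_inner_comm] at h1
    simp only [_root_.add_apply, smul_apply, smul_eq_mul] at h1
    linarith
  have h0 := hess v
  rw [hessian] at h0
  have h1 := congrArg (fun L : TangentSpace I q →L[ℝ] ℝ ↦ L v) hmax
  simp only [hR] at h1
  have hcon (c : ℝ) : MDiffAt (fun _ : M ↦ c) q := mdifferentiableAt_const
  have hερ : MDiffAt (fun y ↦ ε * ρ y) q := (hcon ε).mul hρq
  have hcρ : MDiffAt (fun y ↦ c - ε * ρ y) q := (hcon c).sub hερ
  have hprod : MDiffAt (fun y ↦ (c - ε * ρ y) * √(inner ℝ (X y) (X y))) q := hcρ.mul hsqrt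
  rw [mvfderiv_fun_sub (hX.mvfderiv_apply (hρ q)) hprod, mvfderiv_fun_mul hcρ hsqrt,
    mvfderiv_fun_sub (hcon c) hερ, mvfderiv_fun_mul (hcon ε) hρq, hsq] at h1
  simp only [sub_apply, _root_.add_apply, smul_apply, smul_eq_mul, mvfderiv_const, zero_apply,
    hvw] at h1
  rw [← hXdef, hvw, hXq] at h0
  have hc' : c - ε * ρ q = ‖v‖ := by
    rw [hc]
    ring
  rw [hc', real_inner_self_eq_norm_sq v] at h1
  have : 0 < ε * ‖v‖ ^ 3 := by positivity
  linarith

/-- At a maximum `q` of `|grad ρ| + ερ` the gradient vanishes, so `|grad ρ| ≤ ε (ρ q - ρ x) ≤ 2εC`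
at every `x`, with `C` a bound for `|ρ|`. A small `ε` contradicts a nonzero gradient at `x`. -/
theorem eq_of_hessian_nonneg [I.Boundaryless] [CompactSpace M] [PreconnectedSpace M]
    (hρ : CMDiff ∞ ρ)
    (hess : ∀ (x : M) (v : TangentSpace I x),
      0 ≤ hessian I ρ (FiberBundle.extend EM v) (FiberBundle.extend EM v) x) (x y : M) :
    ρ x = ρ y := by
  refine eq_of_mvfderiv_eq_zero hρ (fun x ↦ ?_) x y
  have hzero : riemannianGradient I ρ x = 0 := by
    by_contra hx
    have : Nonempty M := ⟨x⟩
    have hx0 : 0 < ‖riemannianGradient I ρ x‖ := norm_pos_iff.mpr hx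
    obtain ⟨C, hC⟩ : ∃ C, ∀ y, |ρ y| ≤ C := by
      obtain ⟨y, -, hy⟩ := isCompact_univ.exists_isMaxOn Set.univ_nonempty
        (hρ.continuous.abs.continuousOn)
      exact ⟨|ρ y|, fun z ↦ hy (Set.mem_univ z)⟩
    have hC0 : 0 ≤ C := (abs_nonneg _).trans (hC x)
    obtain ⟨ε, hε, hεC⟩ : ∃ ε : ℝ, 0 < ε ∧ 2 * ε * C < ‖riemannianGradient I ρ x‖ := by
      refine ⟨‖riemannianGradient I ρ x‖ / (2 * C + 1), by positivity, ?_⟩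
      rw [mul_div_assoc', div_mul_eq_mul_div, div_lt_iff₀ (by positivity)]
      nlinarith
    obtain ⟨q, -, hq⟩ := UpperSemicontinuousOn.exists_isMaxOn (s := (Set.univ : Set M))
      (f := fun y ↦ ‖riemannianGradient I ρ y‖ + ε * ρ y) Set.univ_nonempty isCompact_univ
      (((upperSemicontinuous_norm_riemannianGradient hρ).add
        (hρ.continuous.const_smul ε).upperSemicontinuous).upperSemicontinuousOn _)
    have hq : ∀ y, ‖riemannianGradient I ρ y‖ + ε * ρ y ≤ ‖riemannianGradient I ρ q‖ + ε * ρ q :=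
      fun y ↦ hq (Set.mem_univ y)
    have h1 := hq x
    rw [riemannianGradient_eq_zero_of_isMaxOn hρ (hess q) hε hq, norm_zero] at h1
    have h2 := abs_le.1 (hC x)
    have h3 := abs_le.1 (hC q)
    nlinarith
  ext w
  rw [← inner_riemannianGradient, hzero, inner_zero_left]
  rfl

end MaximumPrinciple

/-! ### Sasaki geometry of the function `h(x)‖ξ‖` -/

section Sasaki

open Topology Filter

section Vertical

variable {M F : Type*} {E : M → Type*} [∀ x, NormedAddCommGroup (E x)]
  [∀ x, InnerProductSpace ℝ (E x)]

theorem verticalDeriv_congr {f g : TotalSpace F E → ℝ} (hfg : ∀ η ∈ puncturedBundle F E, f η = g η)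
    {ξ : TotalSpace F E} (hξ : ξ ∈ puncturedBundle F E) :
    verticalDeriv f ξ = verticalDeriv g ξ := by
  refine Filter.EventuallyEq.fderiv_eq ?_
  filter_upwards [isOpen_ne.mem_nhds hξ] with y hy using hfg ⟨ξ.proj, y⟩ hy

theorem verticalDeriv_mul_norm (h : M → ℝ) {ξ : TotalSpace F E} (hξ : ξ ∈ puncturedBundle F E)
    (s : E ξ.proj) :
    verticalDeriv (fun η ↦ h η.proj * ‖η.snd‖) ξ s = h ξ.proj * (inner ℝ ξ.snd s / ‖ξ.snd‖) := by
  have h1 := (hasFDerivAt_norm_of_ne_zero (y := ξ.snd) hξ).const_mul (h ξ.proj)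
  rw [verticalDeriv, h1.fderiv]
  simp [div_eq_inv_mul]

theorem verticalDeriv_mul_inner_div_norm (h : M → ℝ) (t : Π x, E x) {ξ : TotalSpace F E}
    (hξ : ξ ∈ puncturedBundle F E) (s : E ξ.proj) :
    verticalDeriv (fun η ↦ h η.proj * (inner ℝ η.snd (t η.proj) / ‖η.snd‖)) ξ s =
      h ξ.proj * (inner ℝ s (t ξ.proj) / ‖ξ.snd‖
        - inner ℝ ξ.snd (t ξ.proj) * inner ℝ ξ.snd s / ‖ξ.snd‖ ^ 3) := by
  have hn : ‖ξ.snd‖ ≠ 0 := norm_ne_zero_iff.mpr hξ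
  have h1 : HasFDerivAt (fun y : E ξ.proj ↦ inner ℝ y (t ξ.proj))
      (innerSL ℝ (t ξ.proj)) ξ.snd := by
    simp only [real_inner_comm (t ξ.proj)]
    exact (innerSL ℝ (t ξ.proj)).hasFDerivAt
  have h2 := (hasDerivAt_inv hn).comp_hasFDerivAt ξ.snd
    (hasFDerivAt_norm_of_ne_zero (y := ξ.snd) hξ)
  have h3 := (h1.mul h2).const_mul (h ξ.proj)
  simp only [div_eq_mul_inv _ ‖_‖]
  rw [verticalDeriv]
  refine (congrArg (fun L : E ξ.proj →L[ℝ] ℝ ↦ L s) (HasFDerivAt.fderiv h3)).trans ?_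
  rw [← real_inner_comm s]
  simp
  field_simp
  ring

end Vertical

variable {EM : Type*} [NormedAddCommGroup EM] [NormedSpace ℝ EM]
  {H : Type*} [TopologicalSpace H] {I : ModelWithCorners ℝ EM H}
  {M : Type*} [TopologicalSpace M] [ChartedSpace H M]
  {F : Type*} [NormedAddCommGroup F] [NormedSpace ℝ F]
  {E : M → Type*} [TopologicalSpace (TotalSpace F E)]
  [∀ x, NormedAddCommGroup (E x)] [∀ x, InnerProductSpace ℝ (E x)]
  [FiberBundle F E] [VectorBundle ℝ F E] [IsContMDiffRiemannianBundle I ∞ F E]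

theorem MDifferentiableAt.inner_section {σ τ : Π x, E x} {x : M} (hσ : MDiffAt (T% σ) x)
    (hτ : MDiffAt (T% τ) x) : MDiffAt (fun y ↦ inner ℝ (σ y) (τ y)) x :=
  haveI : IsContMDiffRiemannianBundle I 1 F E := .of_le (n := ∞) (by simp)
  MDifferentiableAt.inner_bundle hσ hτ

theorem MDifferentiableAt.norm_section {σ : Π x, E x} {x : M} (hσ : MDiffAt (T% σ) x)
    (h0 : σ x ≠ 0) : MDiffAt (fun y ↦ ‖σ y‖) x := by
  have h1 : (fun y ↦ ‖σ y‖) = fun y ↦ √(inner ℝ (σ y) (σ y)) := by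
    ext y
    exact norm_eq_sqrt_real_inner _
  rw [h1]
  exact (Real.hasDerivAt_sqrt (inner_self_ne_zero.mpr h0)).differentiableAt.mdifferentiableAt.comp x
    (hσ.inner_section hσ)

variable {cov : CovariantDerivative I F E}

/-- The local section through `ξ` stays off the zero section near the base point. This allows first
derivatives to be replaced by formulas valid only off the zero section before differentiating again.
-/
theorem horizontalDeriv_congr {f g : TotalSpace F E → ℝ}
    (hfg : ∀ η ∈ puncturedBundle F E, f η = g η) {ξ : TotalSpace F E}
    (hξ : ξ ∈ puncturedBundle F E) : horizontalDeriv cov f ξ = horizontalDeriv cov g ξ := by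
  have hσ : MDiffAt (T% (FiberBundle.extend F ξ.snd)) ξ.proj :=
    FiberBundle.mdifferentiableAt_extend I F ξ.snd
  have h0 : FiberBundle.extend F ξ.snd ξ.proj ≠ 0 := by simpa using! hξ
  have h1 : ∀ᶠ y in 𝓝 ξ.proj, FiberBundle.extend F ξ.snd y ≠ 0 := by
    have := (hσ.norm_section h0).continuousAt.eventually_ne (norm_ne_zero_iff.mpr h0)
    filter_upwards [this] with y hy using norm_ne_zero_iff.mp hy
  have h2 : (fun x ↦ f ⟨x, FiberBundle.extend F ξ.snd x⟩) =ᶠ[𝓝 ξ.proj]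
      fun x ↦ g ⟨x, FiberBundle.extend F ξ.snd x⟩ := by
    filter_upwards [h1] with y hy using hfg ⟨y, _⟩ hy
  rw [horizontalDeriv, horizontalDeriv, verticalDeriv_congr hfg hξ, mvfderiv, mvfderiv,
    h2.mfderiv_eq]
  rfl

variable [FiniteDimensional ℝ F] [IsManifold I ∞ M] [ContMDiffVectorBundle ∞ F E I]

theorem CovariantDerivative.IsMetricCompatible.mvfderiv_inner_apply
    (hcov : cov.IsMetricCompatible) {x : M} {σ τ : Π x, E x}
    (hσ : MDiffAt (T% σ) x) (hτ : MDiffAt (T% τ) x) (v : TangentSpace I x) :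
    mvfderiv I (fun y ↦ inner ℝ (σ y) (τ y)) x v =
      inner ℝ (cov σ x v) (τ x) + inner ℝ (σ x) (cov τ x v) := by
  have h1 := hcov.mvfderiv_inner_eq (FiberBundle.extend EM v) hσ hτ
  simpa using h1

theorem CovariantDerivative.IsMetricCompatible.mvfderiv_norm_apply
    (hcov : cov.IsMetricCompatible) {x : M} {σ : Π x, E x}
    (hσ : MDiffAt (T% σ) x) (h0 : σ x ≠ 0) (v : TangentSpace I x) :
    mvfderiv I (fun y ↦ ‖σ y‖) x v = inner ℝ (σ x) (cov σ x v) / ‖σ x‖ := by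
  have h1 := hcov.mvfderiv_inner_apply hσ hσ v
  have h2 : (fun y ↦ inner ℝ (σ y) (σ y)) = fun y ↦ ‖σ y‖ * ‖σ y‖ := by
    ext y
    exact real_inner_self_eq_norm_mul_norm _
  have h3 := hσ.norm_section h0
  rw [h2, mvfderiv_fun_mul h3 h3, real_inner_comm] at h1
  simp only [_root_.add_apply, smul_apply, smul_eq_mul] at h1
  rw [eq_div_iff (norm_ne_zero_iff.mpr h0)]
  linarith

/-- For a metric connection the derivative of `‖σ‖` is exactly the vertical correction in
`horizontalDeriv`: the norm is constant along horizontal lifts, and only `h` gets differentiated. -/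
theorem horizontalDeriv_mul_norm (hcov : cov.IsMetricCompatible) {h : M → ℝ} {ξ : TotalSpace F E}
    (hh : MDiffAt h ξ.proj) (hξ : ξ ∈ puncturedBundle F E) (v : TangentSpace I ξ.proj) :
    horizontalDeriv cov (fun η ↦ h η.proj * ‖η.snd‖) ξ v = mvfderiv I h ξ.proj v * ‖ξ.snd‖ := by
  have hσ : MDiffAt (T% (FiberBundle.extend F ξ.snd)) ξ.proj :=
    FiberBundle.mdifferentiableAt_extend I F ξ.snd
  have hs : FiberBundle.extend F ξ.snd ξ.proj = ξ.snd := FiberBundle.extend_apply_self ..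
  have h0 : FiberBundle.extend F ξ.snd ξ.proj ≠ 0 := by simpa using! hξ
  have h1 := hcov.mvfderiv_norm_apply hσ h0 v
  rw [horizontalDeriv, sub_apply, ContinuousLinearMap.comp_apply, verticalDeriv_mul_norm _ hξ,
    mvfderiv_fun_mul hh (hσ.norm_section h0), _root_.add_apply, smul_apply, smul_apply, h1, hs]
  simp only [smul_eq_mul]
  ring

theorem horizontalDeriv_mul_inner_div_norm (hcov : cov.IsMetricCompatible) {h : M → ℝ}
    {t : Π x, E x} {ξ : TotalSpace F E} (hh : MDiffAt h ξ.proj) (ht : MDiffAt (T% t) ξ.proj)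
    (hξ : ξ ∈ puncturedBundle F E) (v : TangentSpace I ξ.proj) :
    horizontalDeriv cov (fun η ↦ h η.proj * (inner ℝ η.snd (t η.proj) / ‖η.snd‖)) ξ v =
      mvfderiv I h ξ.proj v * (inner ℝ ξ.snd (t ξ.proj) / ‖ξ.snd‖)
        + h ξ.proj * (inner ℝ ξ.snd (cov t ξ.proj v) / ‖ξ.snd‖) := by
  have hn : ‖ξ.snd‖ ≠ 0 := norm_ne_zero_iff.mpr hξ
  set σ : Π x, E x := FiberBundle.extend F ξ.snd with hσdef
  have hσ : MDiffAt (T% σ) ξ.proj := FiberBundle.mdifferentiableAt_extend I F ξ.snd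
  have hs : σ ξ.proj = ξ.snd := FiberBundle.extend_apply_self ..
  have h0 : σ ξ.proj ≠ 0 := by rw [hs]; exact hξ
  have h1 := hcov.mvfderiv_norm_apply hσ h0 v
  have h2 := hcov.mvfderiv_inner_apply hσ ht v
  have hnorm := hσ.norm_section h0
  have hinv : MDiffAt (fun y ↦ ‖σ y‖⁻¹) ξ.proj :=
    (hasDerivAt_inv (norm_ne_zero_iff.mpr h0)).differentiableAt.mdifferentiableAt.comp ξ.proj hnorm
  have h3 : mvfderiv I (fun y ↦ ‖σ y‖⁻¹) ξ.proj v =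
      -(inner ℝ (σ ξ.proj) (cov σ ξ.proj v) / ‖σ ξ.proj‖) / ‖σ ξ.proj‖ ^ 2 := by
    have h4 : mvfderiv I (fun y ↦ ‖σ y‖ * ‖σ y‖⁻¹) ξ.proj = 0 := by
      have : (fun y ↦ ‖σ y‖ * ‖σ y‖⁻¹) =ᶠ[𝓝 ξ.proj] fun _ ↦ (1 : ℝ) := by
        filter_upwards [hnorm.continuousAt.eventually_ne (norm_ne_zero_iff.mpr h0)] with y hy
        exact mul_inv_cancel₀ hy
      rw [mvfderiv, this.mfderiv_eq]
      exact mvfderiv_const 1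
    rw [mvfderiv_fun_mul hnorm hinv] at h4
    have h5 := congrArg (fun L : TangentSpace I ξ.proj →L[ℝ] ℝ ↦ L v) h4
    simp only [_root_.add_apply, smul_apply, smul_eq_mul, zero_apply, h1] at h5
    rw [hs] at h5 ⊢
    field_simp at h5 ⊢
    linarith
  have hmul : MDiffAt (fun y ↦ inner ℝ (σ y) (t y) * ‖σ y‖⁻¹) ξ.proj :=
    (hσ.inner_section ht).mul hinv
  rw [horizontalDeriv, sub_apply, ContinuousLinearMap.comp_apply,
    verticalDeriv_mul_inner_div_norm _ _ hξ]
  simp only [← hσdef, div_eq_mul_inv _ ‖σ _‖]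
  rw [mvfderiv_fun_mul hh hmul, mvfderiv_fun_mul (hσ.inner_section ht) hinv]
  simp only [_root_.add_apply, smul_apply, smul_eq_mul, h2, h3, hs]
  field_simp
  ring

variable [FiniteDimensional ℝ EM] [RiemannianBundle (fun x : M ↦ TangentSpace I x)]

/-- The covariant derivative of the extended section cancels against the term `D_{Xʰ} tᵛ`. The two
mixed parts are equal, whence the factor `2`. -/
theorem sasakiHessian_mul_norm (hcov : cov.IsMetricCompatible) {h : M → ℝ} (hh : CMDiff ∞ h)
    {ξ : TotalSpace F E} (hξ : ξ ∈ puncturedBundle F E) (v : TangentSpace I ξ.proj)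
    (s : E ξ.proj) :
    sasakiHessian cov (fun η ↦ h η.proj * ‖η.snd‖) ξ (v, s) (v, s) =
      hessian I h (FiberBundle.extend EM v) (FiberBundle.extend EM v) ξ.proj * ‖ξ.snd‖
        + 2 * mvfderiv I h ξ.proj v * (inner ℝ ξ.snd s / ‖ξ.snd‖)
        + h ξ.proj * (‖s‖ ^ 2 / ‖ξ.snd‖ - inner ℝ ξ.snd s ^ 2 / ‖ξ.snd‖ ^ 3) := by
  have hd (x : M) : MDiffAt h x := (hh x).mdifferentiableAt (by simp)
  set X : Π x : M, TangentSpace I x := FiberBundle.extend EM v with hX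
  have hXx : X ξ.proj = v := FiberBundle.extend_apply_self ..
  have hXd : MDiffAt (T% X) ξ.proj := FiberBundle.mdifferentiableAt_extend ..
  set t : Π x : M, E x := FiberBundle.extend F s with ht
  have htx : t ξ.proj = s := FiberBundle.extend_apply_self ..
  have htd : MDiffAt (T% t) ξ.proj := FiberBundle.mdifferentiableAt_extend I F s
  have e1 : ∀ η ∈ puncturedBundle F E, horizontalDeriv cov (fun η ↦ h η.proj * ‖η.snd‖) η
      (X η.proj) = mvfderiv I h η.proj (X η.proj) * ‖η.snd‖ :=
    fun η hη ↦ horizontalDeriv_mul_norm hcov (hd _) hη _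
  have e2 : ∀ η ∈ puncturedBundle F E, verticalDeriv (fun η ↦ h η.proj * ‖η.snd‖) η
      (t η.proj) = h η.proj * (inner ℝ η.snd (t η.proj) / ‖η.snd‖) :=
    fun η hη ↦ verticalDeriv_mul_norm h hη _
  simp only [sasakiHessian, ← hX, ← ht]
  rw [horizontalDeriv_congr e1 hξ, horizontalDeriv_congr e2 hξ, verticalDeriv_congr e1 hξ,
    verticalDeriv_congr e2 hξ, horizontalDeriv_mul_norm hcov (hd _) hξ,
    horizontalDeriv_mul_norm (h := fun y ↦ mvfderiv I h y (X y)) hcov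
      (hXd.mvfderiv_apply (hh _)) hξ,
    horizontalDeriv_mul_inner_div_norm hcov (hd _) htd hξ, verticalDeriv_mul_norm h hξ,
    verticalDeriv_mul_norm (fun y ↦ mvfderiv I h y (X y)) hξ,
    verticalDeriv_mul_inner_div_norm h t hξ, htx, hXx, hessian, hXx, real_inner_self_eq_norm_sq]
  ring

end Sasaki

/-! ### Radial graphs -/

section Fibres

variable {M : Type*} {F : Type*} {E : M → Type*}
  [∀ x, NormedAddCommGroup (E x)] [∀ x, InnerProductSpace ℝ (E x)]

theorem radialExtension_smul (u : unitSphereBundle F E → ℝ) {c : ℝ} (hc : 0 < c) {x : M} {p : E x}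
    (hp : p ≠ 0) : radialExtension u ⟨x, c • p⟩ = radialExtension u ⟨x, p⟩ := by
  have h1 : (⟨x, c • p⟩ : TotalSpace F E) ∈ puncturedBundle F E := smul_ne_zero hc.ne' hp
  have h2 : (⟨x, p⟩ : TotalSpace F E) ∈ puncturedBundle F E := hp
  rw [radialExtension, radialExtension, dif_pos h1, dif_pos h2]
  congr 2
  change (⟨x, ‖c • p‖⁻¹ • c • p⟩ : TotalSpace F E) = ⟨x, ‖p‖⁻¹ • p⟩
  rw [smul_smul, norm_smul, Real.norm_of_nonneg hc.le, mul_inv, mul_right_comm,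
    inv_mul_cancel₀ hc.ne', one_mul]

theorem apply_eq_of_norm_eq {K : TotalSpace F E → ℝ} {r c : ℝ} (hr : 0 < r)
    (h : ∀ ξ ∈ unitSphereBundle F E, K (dilate r ξ) = c) {ξ : TotalSpace F E}
    (hξ : ‖ξ.snd‖ = r) : K ξ = c := by
  have hp : ξ ∈ puncturedBundle F E := by
    rw [← hξ] at hr
    exact norm_pos_iff.mp hr
  have h1 := h _ (dilate_mem_unitSphereBundle hp)
  rwa [dilate_dilate, hξ, mul_inv_cancel₀ hr.ne', dilate_one] at h1

variable [TopologicalSpace M] [NormedAddCommGroup F] [NormedSpace ℝ F]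
  [TopologicalSpace (TotalSpace F E)] [FiberBundle F E] [VectorBundle ℝ F E]

theorem finrank_fibre (x : M) : Module.finrank ℝ (E x) = Module.finrank ℝ F :=
  ((trivializationAt F E x).continuousLinearEquivAt ℝ x
    (FiberBundle.mem_baseSet_trivializationAt' x)).toLinearEquiv.finrank_eq

variable {EM : Type*} [NormedAddCommGroup EM] [NormedSpace ℝ EM]
  {H : Type*} [TopologicalSpace H] {I : ModelWithCorners ℝ EM H} [ChartedSpace H M]

theorem contMDiff_totalSpaceMk_fibre (x : M) :
    ContMDiff 𝓘(ℝ, E x) (I.prod 𝓘(ℝ, F)) ∞ (fun y : E x ↦ (⟨x, y⟩ : TotalSpace F E)) := by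
  intro y
  rw [contMDiffAt_totalSpace]
  refine ⟨contMDiffAt_const, ?_⟩
  have h1 : (fun y : E x ↦ ((trivializationAt F E x) ⟨x, y⟩).2) =
      (trivializationAt F E x).continuousLinearMapAt ℝ x := by
    ext y
    rw [Trivialization.continuousLinearMapAt_apply, Trivialization.linearMapAt_apply,
      if_pos (FiberBundle.mem_baseSet_trivializationAt' x)]
  exact h1 ▸ ((trivializationAt F E x).continuousLinearMapAt ℝ x).contMDiff.contMDiffAt

end Fibres

namespace RadialGraph

open Topology Filter

variable {EM : Type*} [NormedAddCommGroup EM] [NormedSpace ℝ EM]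
  {H : Type*} [TopologicalSpace H] {I : ModelWithCorners ℝ EM H}
  {M : Type*} [TopologicalSpace M] [ChartedSpace H M]
  {F : Type*} [NormedAddCommGroup F] [NormedSpace ℝ F]
  {E : M → Type*} [TopologicalSpace (TotalSpace F E)]
  [∀ x, NormedAddCommGroup (E x)] [∀ x, InnerProductSpace ℝ (E x)]
  [FiberBundle F E]

theorem definingFunction_zero (Y : RadialGraph I F E) (x : M) :
    Y.definingFunction ⟨x, 0⟩ = 0 := by
  simp [definingFunction]

theorem isSmoothGauge [VectorBundle ℝ F E] (Y : RadialGraph I F E) (x : M) :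
    IsSmoothGauge fun y : E x ↦ Y.definingFunction ⟨x, y⟩ where
  contDiffOn := by
    have h1 : ContMDiffOn 𝓘(ℝ, E x) 𝓘(ℝ, ℝ) ∞
        (fun y : E x ↦ radialExtension Y.logRadius ⟨x, y⟩) {0}ᶜ :=
      Y.smooth.comp (contMDiff_totalSpaceMk_fibre x).contMDiffOn fun y hy ↦ hy
    have h2 : ContDiffOn ℝ ∞ (fun y : E x ↦ ‖y‖) {0}ᶜ :=
      fun y hy ↦ (contDiffAt_norm ℝ hy).contDiffWithinAt
    exact h2.mul h1.contDiffOn.neg.exp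
  pos p hp := mul_pos (norm_pos_iff.mpr hp) (Real.exp_pos _)
  homog c hc p hp := by
    simp only [definingFunction, radialExtension_smul _ hc hp, norm_smul,
      Real.norm_of_nonneg hc.le]
    ring

/-- The graph whose part in each fibre is a sphere, with the radius given by a function on the
base. -/
def ofBase (w : M → ℝ) (hw : CMDiff ∞ w) : RadialGraph I F E where
  logRadius ξ := w (ξ : TotalSpace F E).proj
  smooth := by
    refine ((hw.comp (contMDiff_proj E)).contMDiffOn).congr fun ξ hξ ↦ ?_
    rw [radialExtension, dif_pos hξ]
    rfl

theorem definingFunction_ofBase (w : M → ℝ) (hw : CMDiff ∞ w) :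
    (ofBase w hw : RadialGraph I F E).definingFunction =
      fun ξ ↦ Real.exp (-w ξ.proj) * ‖ξ.snd‖ := by
  ext ξ
  by_cases hξ : ξ ∈ puncturedBundle F E
  · rw [definingFunction, radialExtension, dif_pos hξ, mul_comm]
    rfl
  · have : ξ.snd = 0 := not_not.1 hξ
    simp [definingFunction, this]

theorem mem_carrier_iff {Y : RadialGraph I F E} {h : M → ℝ}
    (hY : Y.definingFunction = fun ξ ↦ h ξ.proj * ‖ξ.snd‖) {ξ : TotalSpace F E} :
    ξ ∈ Y.carrier ↔ h ξ.proj * ‖ξ.snd‖ = 1 := by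
  rw [Y.carrier_eq, hY]
  refine ⟨fun h ↦ h.2, fun h1 ↦ ⟨fun h0 ↦ ?_, h1⟩⟩
  simp [h0] at h1

theorem mem_carrier_ofBase_iff {w : M → ℝ} {hw : CMDiff ∞ w} {ξ : TotalSpace F E} :
    ξ ∈ (ofBase w hw : RadialGraph I F E).carrier ↔ ‖ξ.snd‖ = Real.exp (w ξ.proj) := by
  rw [mem_carrier_iff (h := fun x ↦ Real.exp (-w x)) (definingFunction_ofBase w hw), Real.exp_neg,
    inv_mul_eq_one₀ (Real.exp_ne_zero _), eq_comm]

theorem homothetic_of_definingFunction_eq {Y Z : RadialGraph I F E} {c d : ℝ} (hc : 0 < c)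
    (hd : 0 < d) (hY : Y.definingFunction = fun ξ ↦ c * ‖ξ.snd‖)
    (hZ : Z.definingFunction = fun ξ ↦ d * ‖ξ.snd‖) : Y.Homothetic Z := by
  refine ⟨c / d, by positivity, ?_⟩
  ext ξ
  rw [mem_carrier_iff (h := fun _ ↦ d) hZ]
  constructor
  · intro h1
    refine ⟨dilate (d / c) ξ, ?_, ?_⟩
    · rw [mem_carrier_iff (h := fun _ ↦ c) hY, norm_dilate, abs_of_pos (by positivity), ← h1]
      field_simp
    · rw [dilate_dilate, div_mul_div_cancel₀ hd.ne', div_self hc.ne', dilate_one]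
  · rintro ⟨η, hη, rfl⟩
    rw [mem_carrier_iff (h := fun _ ↦ c) hY] at hη
    rw [norm_dilate, abs_of_pos (by positivity), ← hη]
    field_simp

/-- A homothety with factor `c` shifts the logarithm of the radius by the constant `log c`. -/
theorem not_homothetic_ofBase [∀ x, Nontrivial (E x)] {w₁ w₂ : M → ℝ} {hw₁ : CMDiff ∞ w₁}
    {hw₂ : CMDiff ∞ w₂} {x y : M} (h : w₂ x - w₁ x ≠ w₂ y - w₁ y) :
    ¬ (ofBase w₁ hw₁ : RadialGraph I F E).Homothetic (ofBase w₂ hw₂) := by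
  rintro ⟨c, hc, hcar⟩
  have key (z : M) : w₂ z - w₁ z = Real.log c := by
    obtain ⟨e, he⟩ := exists_norm_eq (E z) (Real.exp_pos (w₁ z)).le
    have h1 : (⟨z, e⟩ : TotalSpace F E) ∈ (ofBase w₁ hw₁ : RadialGraph I F E).carrier :=
      mem_carrier_ofBase_iff.2 he
    have h2 : dilate c (⟨z, e⟩ : TotalSpace F E) ∈ (ofBase w₂ hw₂ : RadialGraph I F E).carrier :=
      hcar ▸ Set.mem_image_of_mem _ h1
    rw [mem_carrier_ofBase_iff, norm_dilate, abs_of_pos hc] at h2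
    change c * ‖e‖ = Real.exp (w₂ z) at h2
    rw [he] at h2
    have h3 := congrArg Real.log h2
    rw [Real.log_mul hc.ne' (Real.exp_ne_zero _), Real.log_exp, Real.log_exp] at h3
    linarith
  exact h ((key x).trans (key y).symm)

section Curvature

variable [FiniteDimensional ℝ F] [VectorBundle ℝ F E]

theorem verticalGaussCurvature_eq {Y : RadialGraph I F E} {h : M → ℝ} (hpos : ∀ x, 0 < h x)
    (hY : Y.definingFunction = fun ξ ↦ h ξ.proj * ‖ξ.snd‖) {ξ : TotalSpace F E}
    (hξ : ξ ∈ puncturedBundle F E) :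
    Y.verticalGaussCurvature ξ = ‖ξ.snd‖⁻¹ ^ (Module.finrank ℝ F - 1) := by
  have : FiniteDimensional ℝ (E ξ.proj) := fibre_finiteDimensional F E ξ.proj
  have : CompleteSpace (E ξ.proj) := fibre_completeSpace F E ξ.proj
  rw [verticalGaussCurvature, hY, ← finrank_fibre (E := E) (F := F) ξ.proj]
  exact gaussCurvature_const_mul_norm (hpos ξ.proj) hξ

theorem hasVerticalGaussCurvature_ofBase {w : M → ℝ} (hw : CMDiff ∞ w) {K : TotalSpace F E → ℝ}
    (hK : ∀ ξ : TotalSpace F E, ‖ξ.snd‖ = Real.exp (w ξ.proj) →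
      K ξ = ‖ξ.snd‖⁻¹ ^ (Module.finrank ℝ F - 1)) :
    (ofBase w hw : RadialGraph I F E).HasVerticalGaussCurvature K := by
  intro ξ hξ
  have h1 := hξ
  rw [carrier_eq] at h1
  rw [verticalGaussCurvature_eq (h := fun x ↦ Real.exp (-w x)) (fun x ↦ Real.exp_pos _)
    (definingFunction_ofBase w hw) h1.1, hK ξ (mem_carrier_ofBase_iff.1 hξ)]

/-- If the vertical Gaussian curvature is at least that of the spheres about the origin, then the
graph meets every fibre in such a sphere. -/
theorem exists_definingFunction_eq (hF : 2 ≤ Module.finrank ℝ F) {Y : RadialGraph I F E}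
    {x : M} (hY : ∀ p : E x, p ≠ 0 → Y.definingFunction ⟨x, p⟩ = 1 →
      ‖p‖⁻¹ ^ (Module.finrank ℝ F - 1) ≤ Y.verticalGaussCurvature ⟨x, p⟩) :
    ∃ c > 0, ∀ p : E x, Y.definingFunction ⟨x, p⟩ = c * ‖p‖ := by
  have : FiniteDimensional ℝ (E x) := fibre_finiteDimensional F E x
  have : CompleteSpace (E x) := fibre_completeSpace F E x
  have hrank : 1 < Module.rank ℝ (E x) := by
    rw [← Module.finrank_eq_rank, finrank_fibre (F := F)]
    exact_mod_cast hF
  obtain ⟨c, hc, h⟩ := (Y.isSmoothGauge x).eq_const_mul_norm hrank fun p hp h1 ↦ by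
    rw [finrank_fibre (F := F)]
    exact hY p hp h1
  refine ⟨c, hc, fun p ↦ ?_⟩
  rcases eq_or_ne p 0 with rfl | hp
  · rw [definingFunction_zero, norm_zero, mul_zero]
  · exact h p hp

end Curvature

end RadialGraph

/-! ### Convexity, existence and uniqueness -/

namespace RadialGraph

open Topology Filter

variable {EM : Type*} [NormedAddCommGroup EM] [NormedSpace ℝ EM]
  {H : Type*} [TopologicalSpace H] {I : ModelWithCorners ℝ EM H}
  {M : Type*} [TopologicalSpace M] [ChartedSpace H M]
  {F : Type*} [NormedAddCommGroup F] [NormedSpace ℝ F]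
  {E : M → Type*} [TopologicalSpace (TotalSpace F E)]
  [∀ x, NormedAddCommGroup (E x)] [∀ x, InnerProductSpace ℝ (E x)]
  [FiberBundle F E] [VectorBundle ℝ F E]

section Existence

variable [FiniteDimensional ℝ F]

/-- If the curvature of a graph is a continuous radial function, then on the sphere of some radius
this function takes the value of the curvature of that sphere. -/
theorem exists_eq_inv_pow (hF : 2 ≤ Module.finrank ℝ F) (Y : RadialGraph I F E) (x : M)
    {k : ℝ → ℝ} (hk : ContinuousOn k (Set.Ioi 0))
    (hY : ∀ p : E x, p ≠ 0 → Y.definingFunction ⟨x, p⟩ = 1 →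
      Y.verticalGaussCurvature ⟨x, p⟩ = k ‖p‖) :
    ∃ r > 0, k r = r⁻¹ ^ (Module.finrank ℝ F - 1) := by
  have : FiniteDimensional ℝ (E x) := fibre_finiteDimensional F E x
  have : CompleteSpace (E x) := fibre_completeSpace F E x
  have : Nontrivial (E x) := by
    refine Module.nontrivial_of_finrank_pos (R := ℝ) ?_
    rw [finrank_fibre (F := F)]
    lia
  -- In the first case rigidity produces a sphere, whose radius is the solution. In the second, `k`
  -- is too small at `a` but large enough at the farthest point of the graph, and continuity gives a
  -- radius in between.
  by_cases h : ∀ r > 0, r⁻¹ ^ (Module.finrank ℝ F - 1) ≤ k r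
  · obtain ⟨c, hc, hcp⟩ := exists_definingFunction_eq hF (Y := Y) (x := x) fun p hp h1 ↦ by
      rw [hY p hp h1]
      exact h _ (norm_pos_iff.mpr hp)
    obtain ⟨p, hp⟩ := exists_norm_eq (E x) (inv_pos.mpr hc).le
    have hp0 : p ≠ 0 := by
      rw [← norm_ne_zero_iff, hp]
      positivity
    refine ⟨c⁻¹, by positivity, ?_⟩
    have h1 : Y.definingFunction ⟨x, p⟩ = 1 := by rw [hcp, hp, mul_inv_cancel₀ hc.ne']
    have h2 : Y.verticalGaussCurvature ⟨x, p⟩ = gaussCurvature (fun y : E x ↦ c * ‖y‖) p := by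
      rw [verticalGaussCurvature]
      congr 1
      exact funext hcp
    rw [← hp, ← hY p hp0 h1, h2, gaussCurvature_const_mul_norm hc hp0, finrank_fibre (F := F)]
  · push Not at h
    obtain ⟨a, ha, hka⟩ := h
    obtain ⟨p, hp, h1, h2, -⟩ := (Y.isSmoothGauge x).exists_inv_norm_pow_le_gaussCurvature
    have h3 : gaussCurvature (fun y : E x ↦ Y.definingFunction ⟨x, y⟩) p = k ‖p‖ := hY p hp h1
    rw [h3, finrank_fibre (F := F)] at h2
    refine isPreconnected_Ioi.intermediate_value₂ ha (norm_pos_iff.mpr hp) hk ?_ hka.le h2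
    exact (continuousOn_id.inv₀ fun r hr ↦ (Set.mem_Ioi.1 hr).ne').pow _

end Existence

/-- The factor `h` is obtained fibre by fibre, with no regularity. Along a smooth nonvanishing local
section it equals `exp (-u)`, which is smooth. -/
theorem contMDiff_of_definingFunction_eq [IsContMDiffRiemannianBundle I ∞ F E]
    [∀ x, Nontrivial (E x)] {Y : RadialGraph I F E} {h : M → ℝ}
    (hY : Y.definingFunction = fun ξ ↦ h ξ.proj * ‖ξ.snd‖) : CMDiff ∞ h := by
  intro x
  obtain ⟨e, he⟩ := exists_ne (0 : E x)
  set σ : Π x, E x := FiberBundle.extend F e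
  have hσx : σ x = e := FiberBundle.extend_apply_self ..
  have hσ : CMDiffAt ∞ (T% σ) x := FiberBundle.contMDiffAt_extend I F e
  have h0 : σ x ≠ 0 := hσx ▸ he
  have hev : {y | σ y ≠ 0} ∈ 𝓝 x := by
    have := ((hσ.mdifferentiableAt (by simp)).norm_section h0).continuousAt.eventually_ne
      (norm_ne_zero_iff.mpr h0)
    filter_upwards [this] with y hy using norm_ne_zero_iff.mp hy
  have h1 : ContMDiffWithinAt I 𝓘(ℝ, ℝ) ∞ (radialExtension Y.logRadius ∘ T% σ) {y | σ y ≠ 0} x :=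
    ContMDiffWithinAt.comp x (Y.smooth ⟨x, σ x⟩ h0) hσ.contMDiffWithinAt fun y hy ↦ hy
  have h2 : CMDiffAt ∞ (fun y ↦ Real.exp (-radialExtension Y.logRadius ⟨y, σ y⟩)) x :=
    (Real.contDiff_exp.comp contDiff_neg).contDiffAt.contMDiffAt.comp x (h1.contMDiffAt hev)
  refine h2.congr_of_eventuallyEq ?_
  filter_upwards [hev] with y hy
  have h3 := congrFun hY ⟨y, σ y⟩
  rw [definingFunction, mul_comm] at h3
  exact (mul_right_cancel₀ (norm_ne_zero_iff.mpr hy) h3).symm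

variable [FiniteDimensional ℝ EM] [IsManifold I ∞ M]
  [RiemannianBundle (fun x : M ↦ TangentSpace I x)]
  [FiniteDimensional ℝ F] [ContMDiffVectorBundle ∞ F E I] [IsContMDiffRiemannianBundle I ∞ F E]
  {cov : CovariantDerivative I F E}

/-- For constant `h` only the vertical part of the Hessian remains, and it is nonnegative by
Cauchy–Schwarz on all vectors, tangent or not. -/
theorem isConvex_ofBase_const (hcov : cov.IsMetricCompatible) (a : ℝ) :
    (ofBase (fun _ ↦ a) contMDiff_const : RadialGraph I F E).IsConvex cov := by
  rintro ξ hξ ⟨v, s⟩ -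
  rw [carrier_eq] at hξ
  have hn : 0 < ‖ξ.snd‖ := norm_pos_iff.mpr hξ.1
  refine div_nonneg ?_ (Real.sqrt_nonneg _)
  rw [definingFunction_ofBase, sasakiHessian_mul_norm (h := fun _ ↦ Real.exp (-a)) hcov
    contMDiff_const hξ.1, hessian]
  simp only [mvfderiv_const, zero_apply, sub_zero, zero_mul, mul_zero, zero_add]
  refine mul_nonneg (Real.exp_pos _).le ?_
  have h1 := abs_real_inner_le_norm ξ.snd s
  have h2 : inner ℝ ξ.snd s ^ 2 ≤ (‖ξ.snd‖ * ‖s‖) ^ 2 :=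
    sq_le_sq' (neg_le_of_abs_le h1) (le_of_abs_le h1)
  rw [sub_nonneg, div_le_div_iff₀ (by positivity) hn]
  nlinarith

theorem hessian_nonneg_of_isConvex [∀ x, Nontrivial (E x)] (hcov : cov.IsMetricCompatible)
    {Y : RadialGraph I F E} (hconv : Y.IsConvex cov) {h : M → ℝ} (hpos : ∀ x, 0 < h x)
    (hY : Y.definingFunction = fun ξ ↦ h ξ.proj * ‖ξ.snd‖) (x : M) (v : TangentSpace I x) :
    0 ≤ hessian I h (FiberBundle.extend EM v) (FiberBundle.extend EM v) x := by
  have hh := contMDiff_of_definingFunction_eq hY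
  obtain ⟨p, hp⟩ := exists_norm_eq (E x) (inv_pos.mpr (hpos x)).le
  have hn : 0 < ‖p‖ := by
    rw [hp]
    exact inv_pos.mpr (hpos x)
  set ξ : TotalSpace F E := ⟨x, p⟩
  have hξ : ξ ∈ puncturedBundle F E := norm_pos_iff.mp hn
  have hcar : ξ ∈ Y.carrier := by
    rw [mem_carrier_iff hY]
    change h x * ‖p‖ = 1
    rw [hp, mul_inv_cancel₀ (hpos x).ne']
  -- The radial vertical component that makes `(v, s)` tangent to the graph. Being radial it
  -- contributes nothing to the vertical part of the Hessian, while the mixed part gives `-2 dh(v)²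
  -- / h`.
  set s : E x := -(mvfderiv I h x v / h x) • p with hs
  have hin : inner ℝ p s = -(mvfderiv I h x v / h x) * ‖p‖ ^ 2 := by
    rw [hs, real_inner_smul_right, real_inner_self_eq_norm_sq]
  have hsn : ‖s‖ ^ 2 = (mvfderiv I h x v / h x) ^ 2 * ‖p‖ ^ 2 := by
    rw [hs, norm_smul, mul_pow, norm_neg, Real.norm_eq_abs, sq_abs]
  have h1 : sasakiDeriv cov Y.definingFunction ξ (v, s) = 0 := by
    rw [sasakiDeriv, hY, horizontalDeriv_mul_norm hcov ((hh x).mdifferentiableAt (by simp)) hξ,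
      verticalDeriv_mul_norm h hξ]
    change mvfderiv I h x v * ‖p‖ + h x * (inner ℝ p s / ‖p‖) = 0
    rw [hin]
    have := (hpos x).ne'
    field_simp
    ring
  have h2 := hconv ξ hcar (v, s) h1
  have hvert : verticalDeriv Y.definingFunction ξ ≠ 0 := by
    intro h0
    have h3 := congrArg (fun L : E ξ.proj →L[ℝ] ℝ ↦ L ξ.snd) h0
    simp only [hY, verticalDeriv_mul_norm h hξ, zero_apply, real_inner_self_eq_norm_sq] at h3
    have : 0 < h x * (‖p‖ ^ 2 / ‖p‖) := mul_pos (hpos x) (by positivity)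
    exact this.ne' h3
  -- The second fundamental form is a quotient; its sign determines that of the Hessian only if the
  -- denominator is not zero.
  have hgrad : 0 < sasakiGradNorm cov Y.definingFunction ξ := by
    refine Real.sqrt_pos.mpr (add_pos_of_nonneg_of_pos (sq_nonneg _) ?_)
    have := norm_pos_iff.mpr hvert
    positivity
  have h3 : 0 ≤ sasakiHessian cov Y.definingFunction ξ (v, s) (v, s) :=
    by
    simpa using! (le_div_iff₀ hgrad).1 h2
  rw [hY, sasakiHessian_mul_norm hcov hh hξ] at h3
  change 0 ≤ hessian I h (FiberBundle.extend EM v) (FiberBundle.extend EM v) x * ‖p‖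
    + 2 * mvfderiv I h x v * (inner ℝ p s / ‖p‖)
    + h x * (‖s‖ ^ 2 / ‖p‖ - inner ℝ p s ^ 2 / ‖p‖ ^ 3) at h3
  rw [hin, hsn] at h3
  have h4 : hessian I h (FiberBundle.extend EM v) (FiberBundle.extend EM v) x * ‖p‖
      + 2 * mvfderiv I h x v * (-(mvfderiv I h x v / h x) * ‖p‖ ^ 2 / ‖p‖)
      + h x * ((mvfderiv I h x v / h x) ^ 2 * ‖p‖ ^ 2 / ‖p‖
        - (-(mvfderiv I h x v / h x) * ‖p‖ ^ 2) ^ 2 / ‖p‖ ^ 3) =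
      ‖p‖ * (hessian I h (FiberBundle.extend EM v) (FiberBundle.extend EM v) x
        - 2 * (mvfderiv I h x v ^ 2 / h x)) := by
    field_simp
    ring
  rw [h4] at h3
  have h5 := nonneg_of_mul_nonneg_right h3 hn
  have h6 : 0 ≤ mvfderiv I h x v ^ 2 / h x := div_nonneg (sq_nonneg _) (hpos x).le
  linarith

/-- A convex graph at least as curved vertically as the spheres about the origin is a sphere
bundle of constant radius. -/
theorem exists_definingFunction_eq_const [I.Boundaryless] [CompactSpace M] [ConnectedSpace M]
    [IsContMDiffRiemannianBundle I ∞ EM (fun x : M ↦ TangentSpace I x)]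
    (hF : 2 ≤ Module.finrank ℝ F) (hcov : cov.IsMetricCompatible) {Y : RadialGraph I F E}
    (hconv : Y.IsConvex cov)
    (hY : ∀ ξ ∈ Y.carrier, ‖ξ.snd‖⁻¹ ^ (Module.finrank ℝ F - 1) ≤ Y.verticalGaussCurvature ξ) :
    ∃ c > 0, Y.definingFunction = fun ξ ↦ c * ‖ξ.snd‖ := by
  have (x : M) : Nontrivial (E x) := by
    refine Module.nontrivial_of_finrank_pos (R := ℝ) ?_
    rw [finrank_fibre (F := F)]
    lia
  choose h hpos hh using fun x ↦ exists_definingFunction_eq hF (Y := Y) (x := x) fun p hp h1 ↦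
    hY ⟨x, p⟩ (Y.carrier_eq ▸ ⟨hp, h1⟩)
  have hdef : Y.definingFunction = fun ξ ↦ h ξ.proj * ‖ξ.snd‖ := funext fun ξ ↦ hh ξ.proj ξ.snd
  obtain ⟨x₀⟩ := ‹ConnectedSpace M›.toNonempty
  refine ⟨h x₀, hpos x₀, ?_⟩
  rw [hdef]
  ext ξ
  rw [eq_of_hessian_nonneg (contMDiff_of_definingFunction_eq hdef)
    (hessian_nonneg_of_isConvex hcov hconv hpos hdef) ξ.proj x₀]

end RadialGraph

/-! ### Nonconstant smooth functions on the base, and the main theorem. -/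

theorem ModelWithCorners.nontrivial_of_finrank_pos {EM : Type*} [NormedAddCommGroup EM] [NormedSpace ℝ EM]
    {H : Type*} [TopologicalSpace H] (I : ModelWithCorners ℝ EM H) [I.Boundaryless]
    (M : Type*) [TopologicalSpace M] [Nonempty M] [ChartedSpace H M]
    (h : 0 < Module.finrank ℝ EM) : Nontrivial M := by
  obtain ⟨x⟩ := ‹Nonempty M›
  have : Nontrivial EM := Module.nontrivial_of_finrank_pos h
  by_contra hM
  rw [not_nontrivial_iff_subsingleton] at hM
  have h1 : (extChartAt I x).target = {extChartAt I x x} := by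
    refine Set.eq_singleton_iff_unique_mem.2 ⟨mem_extChartAt_target x, fun y hy ↦ ?_⟩
    rw [← (extChartAt I x).right_inv hy, Subsingleton.elim ((extChartAt I x).symm y) x]
  exact not_isOpen_singleton _ (h1 ▸ isOpen_extChartAt_target x)

theorem exists_contMDiff_ne {EM : Type*} [NormedAddCommGroup EM] [NormedSpace ℝ EM]
    [FiniteDimensional ℝ EM] {H : Type*} [TopologicalSpace H] (I : ModelWithCorners ℝ EM H)
    (M : Type*) [TopologicalSpace M] [T2Space M] [CompactSpace M] [Nontrivial M]
    [ChartedSpace H M] [IsManifold I ∞ M] :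
    ∃ (w : M → ℝ) (x y : M), CMDiff ∞ w ∧ w x = 0 ∧ w y = 1 := by
  obtain ⟨x, y, hxy⟩ := exists_pair_ne M
  obtain ⟨f, h0, h1, -⟩ := exists_contMDiffMap_zero_one_of_isClosed I (n := ⊤)
    (isClosed_singleton (x := x)) (isClosed_singleton (x := y)) (by simpa using hxy)
  exact ⟨f, x, y, f.contMDiff, h0 rfl, h1 rfl⟩

theorem inv_pow_eq_zpow_one_sub (r : ℝ) {m : ℕ} (hm : 1 ≤ m) :
    r⁻¹ ^ (m - 1) = r ^ (1 - (m : ℤ)) := by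
  rw [inv_pow, ← zpow_natCast, ← zpow_neg]
  congr 1
  lia

end

theorem theorem2
    -- a closed smooth manifold of dimension at least one with a Riemannian metric
    {EM : Type*} [NormedAddCommGroup EM] [NormedSpace ℝ EM] [FiniteDimensional ℝ EM]
    {H : Type*} [TopologicalSpace H] {I : ModelWithCorners ℝ EM H} [I.Boundaryless]
    {M : Type*} [TopologicalSpace M] [T2Space M] [CompactSpace M] [Nonempty M]
    [ChartedSpace H M] [IsManifold I ∞ M]
    [RiemannianBundle (fun x : M ↦ TangentSpace I x)]
    [IsContMDiffRiemannianBundle I ∞ EM (fun x : M ↦ TangentSpace I x)]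
    -- a smooth Riemannian vector bundle of rank at least two
    {F : Type*} [NormedAddCommGroup F] [NormedSpace ℝ F] [FiniteDimensional ℝ F]
    {E : M → Type*} [TopologicalSpace (TotalSpace F E)]
    [∀ x, NormedAddCommGroup (E x)] [∀ x, InnerProductSpace ℝ (E x)]
    [FiberBundle F E] [VectorBundle ℝ F E] [ContMDiffVectorBundle ∞ F E I]
    [IsContMDiffRiemannianBundle I ∞ F E]
    -- a smooth metric connection on it
    (cov : CovariantDerivative I F E) [cov.ContMDiffCovariantDerivative ∞]
    (hcov : cov.IsMetricCompatible)
    {n m : ℕ} (hn : Module.finrank ℝ EM = n) (hn1 : 1 ≤ n)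
    (hm : Module.finrank ℝ F = m) (hm2 : 2 ≤ m)
    -- a smooth positive radial function on the punctured bundle
    (K : TotalSpace F E → ℝ)
    (hK : ContMDiffOn (I.prod 𝓘(ℝ, F)) 𝓘(ℝ, ℝ) ∞ K (puncturedBundle F E))
    (hKpos : ∀ ξ ∈ puncturedBundle F E, 0 < K ξ)
    (hKrad : ∃ k : ℝ → ℝ, ∀ ξ ∈ puncturedBundle F E, K ξ = k ‖ξ.snd‖) :
    ((∃ r : ℝ, 0 < r ∧ ∀ ξ ∈ unitSphereBundle F E, K (dilate r ξ) = r ^ (1 - (m : ℤ))) →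
      ∃ Y : RadialGraph I F E, Y.HasVerticalGaussCurvature K ∧ Y.IsConvex cov) ∧
    ((∃ Y : RadialGraph I F E, Y.HasVerticalGaussCurvature K) →
      ∃ r : ℝ, 0 < r ∧ ∀ ξ ∈ unitSphereBundle F E, K (dilate r ξ) = r ^ (1 - (m : ℤ))) ∧
    ((∀ r : ℝ, 0 < r → ∀ ξ ∈ unitSphereBundle F E, K (dilate r ξ) = r ^ (1 - (m : ℤ))) →
      (∃ Y : ℕ → RadialGraph I F E, (∀ i, (Y i).HasVerticalGaussCurvature K) ∧
        ∀ i j, i ≠ j → ¬ (Y i).Homothetic (Y j)) ∧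
      (∃ Y : RadialGraph I F E, Y.HasVerticalGaussCurvature K ∧ Y.IsConvex cov) ∧
      (ConnectedSpace M → ∀ Y Z : RadialGraph I F E,
        Y.HasVerticalGaussCurvature K → Y.IsConvex cov →
        Z.HasVerticalGaussCurvature K → Z.IsConvex cov → Y.Homothetic Z)) := by
  have hF : 2 ≤ Module.finrank ℝ F := hm ▸ hm2
  have hnt (x : M) : Nontrivial (E x) := by
    refine Module.nontrivial_of_finrank_pos (R := ℝ) ?_
    rw [finrank_fibre (F := F)]
    lia
  have hpow (r : ℝ) : r⁻¹ ^ (Module.finrank ℝ F - 1) = r ^ (1 - (m : ℤ)) := by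
    rw [hm]
    exact inv_pow_eq_zpow_one_sub r (by lia)
  have hsphere : (∃ r : ℝ, 0 < r ∧ ∀ ξ ∈ unitSphereBundle F E,
      K (dilate r ξ) = r ^ (1 - (m : ℤ))) →
      ∃ Y : RadialGraph I F E, Y.HasVerticalGaussCurvature K ∧ Y.IsConvex cov := by
    rintro ⟨r, hr, hKr⟩
    refine ⟨RadialGraph.ofBase (fun _ ↦ Real.log r) contMDiff_const,
      RadialGraph.hasVerticalGaussCurvature_ofBase _ fun ξ hξ ↦ ?_,
      RadialGraph.isConvex_ofBase_const hcov _⟩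
    rw [Real.exp_log hr] at hξ
    rw [apply_eq_of_norm_eq hr hKr hξ, hpow, hξ]
  refine ⟨hsphere, ?_, fun hKr ↦ ?_⟩
  · rintro ⟨Y, hY⟩
    obtain ⟨k, hk⟩ := hKrad
    obtain ⟨x⟩ := ‹Nonempty M›
    obtain ⟨e, he⟩ := exists_norm_eq (E x) zero_le_one
    -- The profile `k` is given as a bare function; its continuity is read off from `K` along one
    -- ray.
    have hkc : ContinuousOn k (Set.Ioi 0) := by
      have h1 : ContinuousOn (fun r : ℝ ↦ K ⟨x, r • e⟩) (Set.Ioi 0) := by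
        have hmk := (contMDiff_totalSpaceMk_fibre (F := F) (E := E) (I := I) x).continuous
        refine hK.continuousOn.comp
          (hmk.comp (continuous_id.smul continuous_const)).continuousOn fun r hr ↦ ?_
        exact smul_ne_zero (Set.mem_Ioi.1 hr).ne' (norm_ne_zero_iff.mp (by simp [he]))
      refine h1.congr fun r hr ↦ ?_
      have hr : 0 < r := hr
      have h2 := hk ⟨x, r • e⟩ (smul_ne_zero hr.ne' (norm_ne_zero_iff.mp (by simp [he])))
      refine Eq.symm (h2.trans ?_)
      rw [norm_smul, he, mul_one, Real.norm_of_nonneg hr.le]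
    obtain ⟨r, hr, hkr⟩ := Y.exists_eq_inv_pow hF x hkc fun p hp h1 ↦ by
      rw [hY ⟨x, p⟩ (Y.carrier_eq ▸ ⟨hp, h1⟩), hk ⟨x, p⟩ hp]
    refine ⟨r, hr, fun ξ hξ ↦ ?_⟩
    have hn : ‖(dilate r ξ).snd‖ = r := by
      rw [norm_dilate, abs_of_pos hr, show ‖ξ.snd‖ = 1 from hξ, mul_one]
    rw [hk _ (norm_pos_iff.mp (hn.symm ▸ hr)), hn, hkr, hpow]
  · have hKξ (ξ : TotalSpace F E) (hξ : 0 < ‖ξ.snd‖) :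
        K ξ = ‖ξ.snd‖⁻¹ ^ (Module.finrank ℝ F - 1) := by
      rw [apply_eq_of_norm_eq hξ (hKr _ hξ) rfl, hpow]
    refine ⟨?_, hsphere ⟨1, one_pos, hKr 1 one_pos⟩, fun hM Y Z hY hYc hZ hZc ↦ ?_⟩
    · have : Nontrivial M := ModelWithCorners.nontrivial_of_finrank_pos I M (by lia)
      obtain ⟨w, x, y, hw, hx, hy⟩ := exists_contMDiff_ne I M
      -- Since `w` takes the values `0` and `1`, the difference `(j - i) w` of two logarithmic radii
      -- is nonconstant for `i ≠ j`.
      refine ⟨fun i ↦ RadialGraph.ofBase (fun z ↦ (i : ℝ) * w z) (contMDiff_const.mul hw),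
        fun i ↦ RadialGraph.hasVerticalGaussCurvature_ofBase _ fun ξ hξ ↦
          hKξ ξ (hξ ▸ Real.exp_pos _), fun i j hij ↦ ?_⟩
      refine RadialGraph.not_homothetic_ofBase (x := x) (y := y) ?_
      rw [hx, hy]
      have : (i : ℝ) ≠ j := by exact_mod_cast hij
      intro h
      apply this
      linarith
    · have key (Y : RadialGraph I F E) (hY : Y.HasVerticalGaussCurvature K)
          (hYc : Y.IsConvex cov) : ∃ c > 0, Y.definingFunction = fun ξ ↦ c * ‖ξ.snd‖ := by
        refine RadialGraph.exists_definingFunction_eq_const hF hcov hYc fun ξ hξ ↦ ?_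
        rw [hY ξ hξ, hKξ ξ]
        rw [Y.carrier_eq] at hξ
        exact norm_pos_iff.mpr hξ.1
      obtain ⟨c, hc, hYd⟩ := key Y hY hYc
      obtain ⟨d, hd, hZd⟩ := key Z hZ hZc
      exact RadialGraph.homothetic_of_definingFunction_eq hc hd hYd hZd
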